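/- Let $q$ be a prime power, let $n \le m$ be positive integers, and write $[e] = q^e$. Let $\alpha = (\alpha_1,\dots,\alpha_m)$ be a basis of $\mathbb F_{q^m}$ over $\mathbb F_q$ and let $\alpha' = (\alpha'_1,\dots,\alpha'_m)$ be its dual basis, $\mathrm{Tr}(\alpha_i\alpha'_j)=\delta_{i,j}$. For $\mathbf c \in \mathbb F_{q^m}^N$ let $M_\alpha(\mathbf c) \in \mathbb F_q^{m\times N}$ be the matrix whose $j$-th column holds the coordinates of $c_j$ in the basis $\alpha$; similarly $M_{\alpha'}$. For an integer $r$ coprime to $m$, for $\mathbf b \in \mathbb F_{q^m}^N$ with entries linearly independent over $\mathbb F_q$, and for $1 \le k \le N$, the generalized Gabidulin code is $$\mathrm{Gab}_{k,m,N}(r,\mathbf b) = \{(F(b_1),\dots,F(b_N)) : F(x)=a_0x+a_1x^{[r]}+\cdots+a_{k-1}x^{[(k-1)r]},\ a_i \in \mathbb F_{q^m}\},$$ where $x \mapsto x^{[e]}$ is the $e$-th power of the Frobenius automorphism $x\mapsto x^q$ of $\mathbb F_{q^m}$. Let $\perp$ denote duality for $\mathbf c\cdot\mathbf d=\sum_i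 c_id_i$ on $\mathbb F_{q^m}^n$, and let ${}^*$ denote duality for $\langle X,Y\rangle=\sum_{i,j}x_{ij}y_{ij}$ on matrices over $\mathbb F_q$. The minimum rank distance $d_R$ of a matrix code is the least rank of a difference of two distinct codewords ($+\infty$ for the zero code). For $\mathbb F_q$-linear codes $\mathcal A,\mathcal C\subseteq\mathbb F_q^{m\times n}$ and $\mathcal B\subseteq\mathbb F_q^{m\times m}$, the pair $(\mathcal A,\mathcal B)$ is a $t$-RECP ($t$-rank error-correcting pair) of type II for $\mathcal C$ if (1) $BA\in\mathcal C^*$ for all $A\in\mathcal A$, $B\in\mathcal B$; (2) $\dim_{\mathbb F_q}\mathcal A>mt$; (3) $d_R(\mathcal B^*)>t$; (4) $d_R(\mathcal A)+d_R(\mathcal C)>n$. Let $t\ge1$ with $2t\le n$, let $r$ be coprime to $m$, let $\mathbf b\in\mathbb F_{q^m}^n$ have entries linearly independent over $\mathbb F_q$, and put $$\mathcal A=\mathrm{Gab}_{t+1,m,n}(r,\mathbf b),\qquad \mathcal B=\mathrm{Gab}_{t,m,m}(r,\alpha),\qquad \mathcal C=\mathrm{Gab}_{2t,m,n}(r,\mathbf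 b)^\perp.$$ If $r=1$, one may also take $\mathcal B=\varphi_n(\mathrm{Gab}_{t,m,n}(1,(\alpha_1,\dots,\alpha_n)))$, where $\varphi_n:\mathbb F_{q^m}^n\to\mathbb F_{q^m}^m$ maps $\mathbf c$ to $(F(\alpha_1),\dots,F(\alpha_m))$ for the unique $q$-linearized polynomial $F$ of degree less than $q^n$ with $F(\alpha_i)=c_i$ for $i\le n$. Let $\mathcal D\subseteq\mathcal C$ be any $\mathbb F_q$-linear subcode. (a) $(M_\alpha(\mathcal A),M_\alpha(\mathcal B))$ is a $t$-RECP of type II for $M_{\alpha'}(\mathcal D)$. (b) $M_{\alpha'}(\mathcal D)$ has an efficient decoder for all errors of rank at most $t$: there is a polynomial $P(m,n)$ and, for all $m,n,p,s,k$ with $p,s,k$ bounded by $mn,m^2,mn$, an algebraic computation tree (nodes: one field operation or one zero test; constants $0,1$ only) of depth at most $P(m,n)$ with the following property. For all $q,\alpha,r,\mathbf b,t,\mathcal A,\mathcal B,\mathcal C,\mathcal D$ as above, run over $\mathbb F_q$ on $\mathbb F_q$-bases of $M_\alpha(\mathcal A)$, $M_\alpha(\mathcal B)$, $M_{\alpha'}(\mathcal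 D)$ (of sizes $p,s,k$) and on $X+E$, where $X\in M_{\alpha'}(\mathcal D)$ and $\mathrm{Rk}(E)\le t$, it outputs $X$. (c) Parts (a) and (b) apply to all $\mathbb F_q$-linear subcodes of generalized Gabidulin codes: if $k\ge1$, $t \ge 1$ and $k+2t\le n$, every code $\mathrm{Gab}_{k,m,n}(r,\mathbf g)$ is contained in a code $\mathcal C$ as above, for the same $t$ and $r$ and a suitable $\mathbf b$. -/

import Mathlib

universe u v

namespace RankECP

section Frobenius

variable (F : Type u) {K : Type v} [Field F] [Fintype F] [Field K] [Algebra F K]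
  [FiniteDimensional F K]

/-- The map `x ↦ x^{[e]}` on the extension `K` of `F = 𝔽_q`, where `[e] = q ^ e`. It is the `e`-th
power of the Frobenius automorphism `x ↦ x ^ q`, so negative exponents `e` make sense too. -/
noncomputable def qPow (e : ℤ) : K ≃ₐ[F] K :=
  FiniteField.frobeniusAlgEquivOfAlgebraic F K ^ e

theorem qPow_natCast (e : ℕ) (x : K) : qPow F (e : ℤ) x = x ^ Fintype.card F ^ e := by
  rw [qPow, zpow_natCast, AlgEquiv.coe_pow, FiniteField.coe_frobeniusAlgEquivOfAlgebraic_iterate]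

/-- The evaluation map `(a₀, …, a_{k-1}) ↦ (G(b₁), …, G(b_n))` where `G` is the linearized
polynomial `G(x) = a₀ x + a₁ x^{[r]} + ⋯ + a_{k-1} x^{[(k-1)r]}`. -/
noncomputable def linearizedEval (k : ℕ) {n : ℕ} (r : ℤ) (b : Fin n → K) :
    (Fin k → K) →ₗ[K] (Fin n → K) where
  toFun a := fun i => ∑ j : Fin k, a j * qPow F ((j : ℤ) * r) (b i)
  map_add' a a' := by
    funext i
    simp [add_mul, Finset.sum_add_distrib]
  map_smul' s a := by
    funext i
    simp [mul_assoc, Finset.mul_sum]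

/-- The generalized Gabidulin code `Gab_{k,m,n}(r, b)`. -/
noncomputable def gabidulin (k : ℕ) {n : ℕ} (r : ℤ) (b : Fin n → K) : Submodule K (Fin n → K) :=
  LinearMap.range (linearizedEval F k r b)

/-- For a nonnegative exponent step, the entries of a Gabidulin codeword are values of an honest
`q`-linearized polynomial. -/
theorem linearizedEval_natCast (k : ℕ) {n : ℕ} (r : ℕ) (b : Fin n → K) (a : Fin k → K)
    (i : Fin n) :
    linearizedEval F k (r : ℤ) b a i =
      (∑ j : Fin k, Polynomial.C (a j) *
        Polynomial.X ^ (Fintype.card F ^ ((j : ℕ) * r))).eval (b i) := by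
  simp only [linearizedEval, LinearMap.coe_mk, AddHom.coe_mk, Polynomial.eval_finsetSum,
    Polynomial.eval_mul, Polynomial.eval_C, Polynomial.eval_pow, Polynomial.eval_X]
  refine Finset.sum_congr rfl fun j _ => ?_
  rw [← Nat.cast_mul, qPow_natCast]

/-- Uniqueness of interpolation by `q`-linearized polynomials of degree less than `q ^ n`. -/
theorem linearizedEval_injective {n : ℕ} (b : Fin n → K) (hb : LinearIndependent F b) :
    Function.Injective (linearizedEval F n 1 b) := by
  classical
  rw [← LinearMap.ker_eq_bot, LinearMap.ker_eq_bot']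
  intro a ha
  have hq : 1 < Fintype.card F := Fintype.one_lt_card
  set p : Polynomial K := ∑ j : Fin n, Polynomial.C (a j) *
    Polynomial.X ^ (Fintype.card F ^ (j : ℕ)) with hp
  have hev : ∀ x : K, p.eval x = ∑ j : Fin n, a j * qPow F ((j : ℕ) : ℤ) x := by
    intro x
    simp only [hp, Polynomial.eval_finsetSum, Polynomial.eval_mul, Polynomial.eval_C,
      Polynomial.eval_pow, Polynomial.eval_X, qPow_natCast]
  have hb0 : ∀ i, ∑ j : Fin n, a j * qPow F ((j : ℕ) : ℤ) (b i) = 0 := by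
    intro i
    simpa [linearizedEval] using congrFun ha i
  have hroot : ∀ c : Fin n → F, p.eval (Fintype.linearCombination F b c) = 0 := by
    intro c
    simp only [hev, Fintype.linearCombination_apply, map_sum, map_smul, Finset.mul_sum,
      mul_smul_comm]
    rw [Finset.sum_comm]
    simp only [← Finset.smul_sum, hb0, smul_zero, Finset.sum_const_zero]
  have hdeg : p.natDegree < Fintype.card (Fin n → F) := by
    rw [Fintype.card_fun, Fintype.card_fin]
    refine lt_of_le_of_lt (Polynomial.natDegree_sum_le_of_forall_le (n := Fintype.card F ^ n - 1)
      _ _ fun j _ => ?_) (Nat.sub_lt (by positivity) one_pos)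
    refine (Polynomial.natDegree_C_mul_X_pow_le _ _).trans (Nat.le_sub_one_of_lt ?_)
    exact Nat.pow_lt_pow_right hq j.2
  have hp0 : p = 0 := Polynomial.eq_zero_of_natDegree_lt_card_of_eval_eq_zero p
    (linearIndependent_iff_injective_fintypeLinearCombination.mp hb) hroot hdeg
  funext j
  have hc : p.coeff (Fintype.card F ^ (j : ℕ)) = a j := by
    simp [hp, Polynomial.coeff_C_mul, Polynomial.coeff_X_pow, Nat.pow_right_inj hq, Fin.val_inj]
  simpa [hp0] using hc.symm

/-- The vector `(α₁, …, α_n)` of the first `n ≤ m` elements of the basis. -/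
noncomputable def firstVec {m n : ℕ} (h : n ≤ m) (α : Module.Basis (Fin m) F K) : Fin n → K :=
  fun i => α (Fin.castLE h i)

/-- The map `φ_n : Kⁿ → Kᵐ` for `n ≤ m`: `φ_n(c) = (G(α₁), …, G(α_m))`, where `G` is the unique
`q`-linearized polynomial of degree less than `q ^ n` with `G(α_i) = c_i` for `i = 1, …, n`. -/
noncomputable def phi {m n : ℕ} (h : n ≤ m) (α : Module.Basis (Fin m) F K) :
    (Fin n → K) →ₗ[K] (Fin m → K) :=
  linearizedEval F n 1 (fun i => α i) ∘ₗ
    (LinearEquiv.ofInjectiveEndo (linearizedEval F n 1 (firstVec F h α))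
      (linearizedEval_injective F _ (α.linearIndependent.comp _ (Fin.castLE_injective h)))).symm.toLinearMap

/-- The dual of a `K`-linear code in `Kⁿ` for the product `c · d = ∑ c_i d_i`. -/
def extDual {n : ℕ} (C : Submodule K (Fin n → K)) : Submodule K (Fin n → K) where
  carrier := {c | ∀ d ∈ C, ∑ i, c i * d i = 0}
  add_mem' hc hc' d hd := by
    simp [add_mul, Finset.sum_add_distrib, hc d hd, hc' d hd]
  zero_mem' d _ := by simp
  smul_mem' s c hc d hd := by
    simp [mul_assoc, ← Finset.mul_sum, hc d hd]

/-- The matrix representation `M_α : Kⁿ → 𝔽_q^{m × n}`: column `j` of `M_α(c)` holds the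
coordinates of `c_j` in the basis `α`. -/
noncomputable def matRep {m : ℕ} (α : Module.Basis (Fin m) F K) (n : ℕ) :
    (Fin n → K) →ₗ[F] Matrix (Fin m) (Fin n) F where
  toFun c := Matrix.of fun i j => α.repr (c j) i
  map_add' c c' := by
    ext i j
    simp
  map_smul' s c := by
    ext i j
    simp

/-- The image under `M_α` of an `F`-linear code in `Kⁿ`. -/
noncomputable def matCode {m : ℕ} (α : Module.Basis (Fin m) F K) {n : ℕ}
    (D : Submodule F (Fin n → K)) : Submodule F (Matrix (Fin m) (Fin n) F) :=
  D.map (matRep F α n)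

/-- The bases `α` and `α'` are dual (orthogonal) with respect to the trace of `K / F`. -/
def IsDualBasis {m : ℕ} (α α' : Module.Basis (Fin m) F K) : Prop :=
  ∀ i j, Algebra.trace F K (α i * α' j) = if i = j then 1 else 0

/-- The data of the type I error-correcting pair of Gabidulin codes: `A = Gab_{t+1,m,n}(r, b)`,
`C = Gab_{2t,m,n}(r, b)^⊥` and `B = Gab_{t,m,m}(r, α)`; if `r = 1`, then `B` may also be given by
`Gab_{t,m,n}(1, α_n) ⊆ Kⁿ`, which stands for its image in `Kᵐ` under `φ_n`. -/
structure IsGabidulinTriple {m n : ℕ} (α : Module.Basis (Fin m) F K) (r : ℤ) (b : Fin n → K)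
    (t : ℕ) (A : Submodule K (Fin n → K)) (B : Submodule K (Fin m → K))
    (C : Submodule K (Fin n → K)) : Prop where
  n_le_m : n ≤ m
  t_pos : 0 < t
  two_mul_t_le : 2 * t ≤ n
  coprime : IsCoprime r (m : ℤ)
  linearIndependent : LinearIndependent F b
  eq_A : A = gabidulin F (t + 1) r b
  eq_B : B = gabidulin F t r (fun i => α i) ∨
    (r = 1 ∧ B = (gabidulin F t 1 (firstVec F n_le_m α)).map (phi F n_le_m α))
  eq_C : C = extDual (gabidulin F (2 * t) r b)

end Frobenius

section MatrixCodes

variable {F : Type u} [Field F] {l m n : ℕ}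

/-- The minimum rank distance of a matrix code: the least rank of a difference of two distinct
codewords. It is `⊤` for a code with a single codeword. -/
noncomputable def minRankDist (C : Submodule F (Matrix (Fin m) (Fin n) F)) : ℕ∞ :=
  ⨅ X ∈ C, ⨅ Y ∈ C, ⨅ _ : X ≠ Y, ((X - Y).rank : ℕ∞)

/-- The dual `C^*` for the base (trace) product `⟨X, Y⟩ = ∑ x_{ij} y_{ij}`. -/
def baseDual (C : Submodule F (Matrix (Fin m) (Fin n) F)) :
    Submodule F (Matrix (Fin m) (Fin n) F) where
  carrier := {X | ∀ Y ∈ C, ∑ i, ∑ j, X i j * Y i j = 0}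
  add_mem' hX hX' Y hY := by
    simp [add_mul, Finset.sum_add_distrib, hX Y hY, hX' Y hY]
  zero_mem' Y _ := by simp
  smul_mem' s X hX Y hY := by
    simp [mul_assoc, ← Finset.mul_sum, hX Y hY]

/-- The `F`-span of the products `Y X` with `Y ∈ B` and `X ∈ A`. -/
def mulCode (B : Submodule F (Matrix (Fin l) (Fin m) F))
    (A : Submodule F (Matrix (Fin m) (Fin n) F)) : Submodule F (Matrix (Fin l) (Fin n) F) :=
  Submodule.span F {Z | ∃ Y ∈ B, ∃ X ∈ A, Z = Y * X}

/-- `(A, B)` is a `t`-rank error-correcting pair of type II for `C`. -/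
structure IsRECPTypeII (t : ℕ) (A : Submodule F (Matrix (Fin m) (Fin n) F))
    (B : Submodule F (Matrix (Fin m) (Fin m) F))
    (C : Submodule F (Matrix (Fin m) (Fin n) F)) : Prop where
  mul_le : mulCode B A ≤ baseDual C
  dim_gt : m * t < Module.finrank F A
  dual_dist : (t : ℕ∞) < minRankDist (baseDual B)
  dist_add : (n : ℕ∞) < minRankDist A + minRankDist C

/-- The family `g` is a basis of the matrix code `C`. -/
def IsBasisOf {k : ℕ} (g : Fin k → Matrix (Fin m) (Fin n) F)
    (C : Submodule F (Matrix (Fin m) (Fin n) F)) : Prop :=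
  LinearIndependent F g ∧ Submodule.span F (Set.range g) = C

end MatrixCodes

/-- One arithmetic operation of a field, with registers labelled by `V` as operands. -/
inductive ArithOp (V : Type) : Type
  | zero : ArithOp V
  | one : ArithOp V
  | add (x y : V) : ArithOp V
  | sub (x y : V) : ArithOp V
  | mul (x y : V) : ArithOp V
  | inv (x : V) : ArithOp V

/-- The value of an operation; the inverse of `0` is `0`. -/
def ArithOp.eval {V : Type} {F : Type u} [Field F] (μ : V → F) : ArithOp V → F
  | .zero => 0
  | .one => 1
  | .add x y => μ x + μ y
  | .sub x y => μ x - μ y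
  | .mul x y => μ x * μ y
  | .inv x => (μ x)⁻¹

/-- Algebraic computation trees. The registers hold field elements and are labelled by `V`; a node
either performs one field operation and stores its value in a register, or tests one register for
zero and branches. A leaf names the registers that hold the outputs, which are labelled by `O`. No
field constants other than `0` and `1` are available, so a tree can be run over every field. -/
inductive CompTree (V O : Type) : Type
  | output (out : O → V) : CompTree V O
  | assign (dst : V) (op : ArithOp V) (next : CompTree V O) : CompTree V O
  | branch (x : V) (ifZero ifNonzero : CompTree V O) : CompTree V O

/-- The cost of a tree in the worst case: the largest number of field operations and zero tests on
a path from the root to a leaf. -/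
def CompTree.cost {V O : Type} : CompTree V O → ℕ
  | .output _ => 0
  | .assign _ _ next => next.cost + 1
  | .branch _ T T' => max T.cost T'.cost + 1

open Classical in
/-- The outputs of a tree that is run with initial register contents `μ`. -/
noncomputable def CompTree.run {V O : Type} {F : Type u} [Field F] :
    CompTree V O → (V → F) → O → F
  | .output out, μ => fun o => μ (out o)
  | .assign dst op next, μ => next.run (Function.update μ dst (op.eval μ))
  | .branch x T T', μ => if μ x = 0 then T.run μ else T'.run μ

/-- The field elements that a decoder gets as input: the entries of `p` matrices that generate the
first code of the pair, of `s` matrices that generate the second one, of `k` matrices that generate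
the code to be decoded, and of the received matrix. -/
inductive DecoderInput (m n p s k : ℕ) : Type
  | genA (h : Fin p) (i : Fin m) (j : Fin n) : DecoderInput m n p s k
  | genB (h : Fin s) (i : Fin m) (j : Fin m) : DecoderInput m n p s k
  | genD (h : Fin k) (i : Fin m) (j : Fin n) : DecoderInput m n p s k
  | received (i : Fin m) (j : Fin n) : DecoderInput m n p s k

/-- A decoder is a computation tree that has, besides its input registers, work registers numbered
by natural numbers, and whose output is an `m × n` matrix. -/
abbrev Decoder (m n p s k : ℕ) : Type :=
  CompTree (DecoderInput m n p s k ⊕ ℕ) (Fin m × Fin n)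

/-- The matrix that a decoder returns on the given input; all work registers start at `0`. -/
noncomputable def Decoder.decode {F : Type u} [Field F] {m n p s k : ℕ} (T : Decoder m n p s k)
    (gA : Fin p → Matrix (Fin m) (Fin n) F) (gB : Fin s → Matrix (Fin m) (Fin m) F)
    (gD : Fin k → Matrix (Fin m) (Fin n) F) (R : Matrix (Fin m) (Fin n) F) :
    Matrix (Fin m) (Fin n) F :=
  Matrix.of fun i j => CompTree.run T
    (Sum.elim
      (fun v => match v with
        | .genA h i j => gA h i j
        | .genB h i j => gB h i j
        | .genD h i j => gD h i j
        | .received i j => R i j)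
      (fun _ => 0)) (i, j)

end RankECP

-- Let σ be the `r`-th power of Frobenius. As `r` is coprime to `m`, the fixed field of σ is `F`, so
-- the Moore matrices (σ^j(β_i)) of `F`-independent β are invertible (`moore_left_injective`,
-- `moore_right_injective`). This gives both rank bounds: a nonzero word of `gabidulin F k r b` has
-- rank at least n - k + 1, a nonzero word of its dual has rank greater than k. Coordinate matrices
-- turn composition of linearized polynomials into matrix products, and for dual bases the base
-- product is the trace of the product over `K`. Hence products of words of `B` and `A` are
-- polynomials with t + (t + 1) - 1 = 2t terms, orthogonal to `C`, and the other axioms follow from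
-- the rank bounds (`IsGabidulinTriple.isRECPTypeII`). Decoding R = X + E rests on ⟨E, ZY⟩ = ⟨Z, E
-- Yᵀ⟩. A homogeneous system computable from R finds a nonzero Y in `A` with E Yᵀ orthogonal to `B`,
-- and E Yᵀ = 0 because its rank is at most t. A second system finds the codeword that agrees with R
-- after multiplication by Yᵀ; the distance condition makes it unique. Both systems are solved by
-- elimination with zero tests, so a single tree serves all fields. `Solvable` builds that tree
-- backwards: each lemma turns a tree for the remaining work into a tree with one more stage in
-- front. For the last claim, `b` is chosen orthogonal to n - 1 consecutive twists of a shift of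
-- `g`.

universe w

namespace RankECP

/-! ### Moore matrices and vectors of small rank. -/

section Moore

variable {F : Type u} {K : Type v} [Field F] [Field K] [Algebra F K]

/-- Scale a solution so that its last entry is 1. Applying σ to equation j and comparing with
equation j + 1 cancels the last term and leaves a shorter system for σ(δ_i) - δ_i with the
independent elements σ(β_i). So every δ_i is fixed by σ and lies in `F`, and equation 0 is a
nontrivial `F`-relation among the β_i. -/
theorem moore_left_injective (σ : K ≃ₐ[F] K) (hσ : ∀ x, σ x = x → x ∈ (algebraMap F K).range) :
    ∀ (s : ℕ) (β γ : Fin s → K), LinearIndependent F β →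
      (∀ j < s, ∑ i, (σ ^ j) (β i) * γ i = 0) → γ = 0 := by
  intro s
  induction s with
  | zero => intro β γ _ _; exact Subsingleton.elim _ _
  | succ s ih =>
    intro β γ hβ h
    have hβ' : LinearIndependent F (fun i : Fin s => β i.castSucc) :=
      hβ.comp _ (Fin.castSucc_injective s)
    by_cases h0 : γ (Fin.last s) = 0
    · have h1 := ih _ (fun i => γ i.castSucc) hβ' fun j hj => by
        have := h j (by omega)
        rwa [Fin.sum_univ_castSucc, h0, mul_zero, add_zero] at this
      funext i
      refine Fin.lastCases h0 (fun i => congrFun h1 i) i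
    · exfalso
      set δ : Fin (s + 1) → K := fun i => γ i / γ (Fin.last s) with hδ
      have hδl : δ (Fin.last s) = 1 := div_self h0
      have hδs : ∀ j < s + 1, ∑ i, (σ ^ j) (β i) * δ i = 0 := fun j hj => by
        simp only [hδ, mul_div_assoc', ← Finset.sum_div, h j hj, zero_div]
      have hβσ : LinearIndependent F (fun i : Fin s => σ (β i.castSucc)) :=
        hβ'.map' σ.toLinearMap (LinearMap.ker_eq_bot.2 σ.injective)
      have h1 := ih _ (fun i => σ (δ i.castSucc) - δ i.castSucc) hβσ fun j hj => by
        have e1 := hδs (j + 1) (by omega)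
        have e2 := congrArg σ (hδs j (by omega))
        rw [map_sum, map_zero] at e2
        simp only [map_mul] at e2
        simp only [← AlgEquiv.mul_apply, ← pow_succ'] at e2
        rw [Fin.sum_univ_castSucc, hδl] at e1 e2
        rw [map_one] at e2
        simp only [← AlgEquiv.mul_apply, ← pow_succ, mul_sub, Finset.sum_sub_distrib]
        rw [sub_eq_zero]
        exact add_right_cancel (e2.trans e1.symm)
      have hfix : ∀ i, ∃ c : F, algebraMap F K c = δ i := fun i =>
        Fin.lastCases ⟨1, by rw [hδl, map_one]⟩
          (fun i => hσ _ (sub_eq_zero.1 (congrFun h1 i))) i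
      choose c hc using hfix
      have h2 : ∑ i, c i • β i = 0 := by
        rw [← hδs 0 (by omega)]
        refine Finset.sum_congr rfl fun i _ => ?_
        rw [Algebra.smul_def, hc, pow_zero, AlgEquiv.one_apply, mul_comm]
      have h3 := Fintype.linearIndependent_iff.1 hβ c h2 (Fin.last s)
      have h4 := hc (Fin.last s)
      rw [h3, map_zero, hδl] at h4
      exact zero_ne_one h4

/-- The Moore matrix is square, so the trivial kernel on one side forces the trivial kernel on the
other. -/
theorem moore_right_injective (σ : K ≃ₐ[F] K) (hσ : ∀ x, σ x = x → x ∈ (algebraMap F K).range)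
    {s : ℕ} (β a : Fin s → K) (hβ : LinearIndependent F β)
    (h : ∀ i, ∑ j : Fin s, a j * (σ ^ (j : ℕ)) (β i) = 0) : a = 0 := by
  set M : Matrix (Fin s) (Fin s) K := Matrix.of fun j i => (σ ^ (j : ℕ)) (β i) with hM
  have hdet : M.det ≠ 0 := by
    intro hd
    obtain ⟨γ, hγ, hz⟩ := Matrix.exists_mulVec_eq_zero_iff.2 hd
    exact hγ (moore_left_injective σ hσ s β γ hβ fun j hj => congrFun hz ⟨j, hj⟩)
  by_contra ha
  exact hdet (Matrix.exists_vecMul_eq_zero_iff.1 ⟨a, ha, funext h⟩)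

/-- A matrix factors through a basis of its row space. -/
theorem exists_row_factorization {m n : ℕ} (X : Matrix (Fin m) (Fin n) F) :
    ∃ (P : Fin m → Fin X.rank → F) (u : Fin X.rank → Fin n → F), LinearIndependent F u ∧
      ∀ i j, X i j = ∑ l, P i l * u l j := by
  set S := Submodule.span F (Set.range X.row) with hS
  have hr : Module.finrank F S = X.rank := X.rank_eq_finrank_span_row.symm
  let B := Module.finBasisOfFinrankEq F S hr
  refine ⟨fun i l => B.repr ⟨X.row i, Submodule.subset_span ⟨i, rfl⟩⟩ l, fun l => (B l : Fin n → F),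
    B.linearIndependent.map' S.subtype (Submodule.ker_subtype S), fun i j => ?_⟩
  have h := congrArg Subtype.val (B.sum_repr ⟨X.row i, Submodule.subset_span ⟨i, rfl⟩⟩)
  rw [Submodule.coe_sum] at h
  have h' := congrFun h j
  rw [Finset.sum_apply] at h'
  exact h'.symm

theorem linearIndependent_combination {n s : ℕ} {b : Fin n → K} (hb : LinearIndependent F b)
    {u : Fin s → Fin n → F} (hu : LinearIndependent F u) :
    LinearIndependent F (fun l => ∑ j, u l j • b j) := by
  have := hu.map' (Fintype.linearCombination F b)
    (LinearMap.ker_eq_bot.2 (linearIndependent_iff_injective_fintypeLinearCombination.1 hb))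
  exact this

/-- A vector of rank at most `k` that is orthogonal to the first `k` Frobenius twists of an
independent vector vanishes. -/
theorem eq_zero_of_rank_le {m n k : ℕ} (σ : K ≃ₐ[F] K)
    (hσ : ∀ x, σ x = x → x ∈ (algebraMap F K).range) {b : Fin n → K} (hb : LinearIndependent F b)
    (α : Fin m → K) (X : Matrix (Fin m) (Fin n) F) (e : Fin n → K)
    (he : ∀ j, e j = ∑ i, X i j • α i) (hX : X.rank ≤ k)
    (h : ∀ d < k, ∑ j, (σ ^ d) (b j) * e j = 0) : e = 0 := by
  obtain ⟨P, u, hu, hPu⟩ := exists_row_factorization X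
  have he' : ∀ j, e j = ∑ l, u l j • ∑ i, P i l • α i := fun j => by
    simp only [he, hPu, Finset.sum_smul, Finset.smul_sum, smul_smul]
    rw [Finset.sum_comm]
    simp only [mul_comm]
  -- Regrouping along X = P u expresses `e` through only `X.rank` elements of `K`, which solve a
  -- Moore system with nodes ∑ u_lj b_j.
  have hγ : (fun l => ∑ i, P i l • α i) = 0 :=
    moore_left_injective σ hσ _ (fun l => ∑ j, u l j • b j) _
      (linearIndependent_combination hb hu) fun d hd => by
      rw [← h d (lt_of_lt_of_le hd hX)]
      simp only [he', map_sum, map_smul, Finset.sum_mul]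
      rw [Finset.sum_comm]
      refine Finset.sum_congr rfl fun j _ => ?_
      rw [Finset.mul_sum]
      refine Finset.sum_congr rfl fun l _ => ?_
      rw [Algebra.smul_mul_assoc, Algebra.mul_smul_comm]
  funext j
  rw [he' j]
  exact Finset.sum_eq_zero fun l _ => by rw [congrFun hγ l, Pi.zero_apply, smul_zero]

end Moore

/-! ### The fixed field of a power of Frobenius. -/

section Frobenius

variable (F : Type u) {K : Type v} [Field F] [Fintype F] [Field K] [Algebra F K]
  [FiniteDimensional F K]

theorem qPow_mul (j : ℕ) (r : ℤ) : (qPow F ((j : ℤ) * r) : K ≃ₐ[F] K) = qPow F r ^ j := by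
  rw [qPow, qPow, mul_comm, zpow_mul, zpow_natCast]

theorem qPow_add_apply (i j : ℤ) (x : K) : qPow F (i + j) x = qPow F i (qPow F j x) := by
  rw [qPow, zpow_add]; rfl

/-- Frobenius has order m, so by Bézout it is itself a power of `qPow F r`; whatever the latter
fixes is fixed by the whole Galois group. -/
theorem qPow_fixed {r : ℤ} {m : ℕ} (hm : Module.finrank F K = m) (hr : IsCoprime r (m : ℤ)) (x : K)
    (hx : qPow F r x = x) : x ∈ (algebraMap F K).range := by
  obtain ⟨a, c, hac⟩ := hr
  have : Finite K := Module.finite_of_finite F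
  have hst : ∀ z : ℤ, (qPow F r ^ z) x = x := fun z => by
    have : qPow F r ∈ MulAction.stabilizer (K ≃ₐ[F] K) x := hx
    exact (MulAction.stabilizer (K ≃ₐ[F] K) x).zpow_mem this z
  have hm1 : FiniteField.frobeniusAlgEquivOfAlgebraic F K ^ (m : ℤ) = 1 := by
    rw [zpow_natCast, ← hm, ← FiniteField.orderOf_frobeniusAlgEquivOfAlgebraic F K,
      pow_orderOf_eq_one]
  have h1 : FiniteField.frobeniusAlgEquivOfAlgebraic F K = qPow F r ^ a := by
    rw [qPow, ← zpow_mul]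
    nth_rewrite 1 [← zpow_one (FiniteField.frobeniusAlgEquivOfAlgebraic F K), ← hac]
    rw [zpow_add, mul_comm c, zpow_mul _ (m : ℤ) c, hm1, one_zpow, mul_one, mul_comm]
  have hf : FiniteField.frobeniusAlgEquivOfAlgebraic F K x = x := by
    rw [h1]; exact hst a
  have hb : x ∈ (⊥ : IntermediateField F K) := by
    rw [IsGalois.mem_bot_iff_fixed]
    intro f
    obtain ⟨i, rfl⟩ := (FiniteField.bijective_frobeniusAlgEquivOfAlgebraic_pow F K).2 f
    have : FiniteField.frobeniusAlgEquivOfAlgebraic F K ∈ MulAction.stabilizer (K ≃ₐ[F] K) x := hf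
    exact (MulAction.stabilizer (K ≃ₐ[F] K) x).pow_mem this _
  exact IntermediateField.mem_bot.1 hb

end Frobenius
-- Bounds for the minimum rank distance.
section MatrixCodes

variable {F : Type u} [Field F] {m n : ℕ}

theorem le_minRankDist {C : Submodule F (Matrix (Fin m) (Fin n) F)} {d : ℕ}
    (h : ∀ X ∈ C, X ≠ 0 → d ≤ X.rank) : (d : ℕ∞) ≤ minRankDist C :=
  le_iInf₂ fun _ hX => le_iInf₂ fun _ hY => le_iInf fun hXY =>
    Nat.cast_le.2 (h _ (C.sub_mem hX hY) (sub_ne_zero.2 hXY))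

theorem minRankDist_le {C : Submodule F (Matrix (Fin m) (Fin n) F)} {X : Matrix (Fin m) (Fin n) F}
    (hX : X ∈ C) (h0 : X ≠ 0) : minRankDist C ≤ X.rank := by
  refine (iInf₂_le X hX).trans ((iInf₂_le 0 C.zero_mem).trans ((iInf_le _ h0).trans ?_))
  rw [sub_zero]

end MatrixCodes

/-! ### Coordinate matrices, composition and trace duality. -/

section Coordinates

variable {F : Type u} {K : Type v} [Field F] [Field K] [Algebra F K] {m n : ℕ}

theorem matRep_injective (α : Module.Basis (Fin m) F K) : Function.Injective (matRep F α n) := by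
  intro c c' h
  funext j
  exact α.repr.injective (Finsupp.ext fun i => congrFun (congrFun h i) j)

theorem sum_matRep_smul (α : Module.Basis (Fin m) F K) (c : Fin n → K) (j : Fin n) :
    c j = ∑ i, matRep F α n c i j • α i :=
  (α.sum_repr (c j)).symm

theorem exists_matRep_eq (α : Module.Basis (Fin m) F K) (X : Matrix (Fin m) (Fin n) F) :
    ∃ c, matRep F α n c = X := by
  refine ⟨fun j => ∑ i, X i j • α i, ?_⟩
  ext i j
  change α.repr (∑ i, X i j • α i) i = _
  rw [α.repr_sum_self]

/-- Composition of linearized polynomials corresponds to the product of coordinate matrices. -/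
theorem matRep_mul_matRep (α : Module.Basis (Fin m) F K) (G : K →ₗ[F] K) (c : Fin n → K) :
    matRep F α m (fun i => G (α i)) * matRep F α n c = matRep F α n (fun j => G (c j)) := by
  ext i j
  rw [Matrix.mul_apply]
  change ∑ k, α.repr (G (α k)) i * α.repr (c j) k = α.repr (G (c j)) i
  conv_rhs => rw [← α.sum_repr (c j)]
  rw [map_sum, map_sum, Finsupp.finsetSum_apply]
  simp [mul_comm]

theorem sum_matRep_mul_matRep {α α' : Module.Basis (Fin m) F K} (hd : IsDualBasis F α α')
    (c d : Fin n → K) :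
    ∑ i, ∑ j, matRep F α n c i j * matRep F α' n d i j = Algebra.trace F K (∑ j, c j * d j) := by
  rw [map_sum, Finset.sum_comm]
  refine Finset.sum_congr rfl fun j _ => ?_
  rw [sum_matRep_smul α c j, sum_matRep_smul α' d j, Finset.sum_mul_sum, map_sum]
  refine Finset.sum_congr rfl fun i _ => ?_
  rw [map_sum, Finset.sum_eq_single i]
  · rw [smul_mul_smul_comm, map_smul, hd i i, if_pos rfl, smul_eq_mul, mul_one]
  · intro i' _ hi
    rw [smul_mul_smul_comm, map_smul, hd i i', if_neg hi.symm, smul_zero]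
  · simp

theorem eq_zero_of_trace_mul_eq_zero {α α' : Module.Basis (Fin m) F K} (hd : IsDualBasis F α α')
    (y : K) (h : ∀ s, Algebra.trace F K (s * y) = 0) : y = 0 := by
  have hy : ∀ i, α'.repr y i = 0 := fun i => by
    have h1 := h (α i)
    rw [← α'.sum_repr y, Finset.mul_sum, map_sum, Finset.sum_eq_single i] at h1
    · rwa [mul_smul_comm, map_smul, hd i i, if_pos rfl, smul_eq_mul, mul_one] at h1
    · intro i' _ hi
      rw [mul_smul_comm, map_smul, hd i i', if_neg hi.symm, smul_zero]
    · simp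
  rw [← α'.sum_repr y]
  exact Finset.sum_eq_zero fun i _ => by rw [hy, zero_smul]

/-- The base dual of a matrix code of a `K`-linear code is represented by the dual code. -/
theorem mem_extDual_of_matRep_mem_baseDual {α α' : Module.Basis (Fin m) F K}
    (hd : IsDualBasis F α α') {B : Submodule K (Fin n → K)} {e : Fin n → K}
    (he : matRep F α' n e ∈ baseDual (matCode F α (B.restrictScalars F))) : e ∈ extDual B := by
  intro d hdB
  refine eq_zero_of_trace_mul_eq_zero hd _ fun s => ?_
  -- The code is `K`-linear, so all multiples of `d` may be tested; nondegeneracy of the trace lifts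
  -- the relation from `F` to `K`.
  have h := he _ ⟨s • d, B.smul_mem s hdB, rfl⟩
  simp only [mul_comm (matRep F α' n e _ _)] at h
  rw [sum_matRep_mul_matRep hd] at h
  rw [← h, Finset.mul_sum]
  exact congrArg _ (Finset.sum_congr rfl fun j _ => by
    rw [Pi.smul_apply, smul_eq_mul, mul_assoc, mul_comm (e j)])

end Coordinates

/-! ### Rank distance and products of Gabidulin codes; the error-correcting pair. -/

section Frobenius

variable (F : Type u) {K : Type v} [Field F] [Fintype F] [Field K] [Algebra F K]
  [FiniteDimensional F K]

theorem linearizedEval_apply (k : ℕ) {n : ℕ} (r : ℤ) (b : Fin n → K) (a : Fin k → K) (i : Fin n) :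
    linearizedEval F k r b a i = ∑ j : Fin k, a j * (qPow F r ^ (j : ℕ)) (b i) := by
  simp only [← qPow_mul]
  rfl

theorem twist_mem_gabidulin {k n d : ℕ} (r : ℤ) (b : Fin n → K) (hd : d < k) :
    (fun i => (qPow F r ^ d) (b i)) ∈ gabidulin F k r b := by
  classical
  refine ⟨Pi.single ⟨d, hd⟩ 1, funext fun i => ?_⟩
  rw [linearizedEval_apply, Finset.sum_eq_single ⟨d, hd⟩]
  · simp
  · intro j _ hj
    rw [Pi.single_eq_of_ne hj, zero_mul]
  · simp

theorem twist_sum_eq_zero_of_mem_extDual {k n : ℕ} {r : ℤ} {b e : Fin n → K}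
    (he : e ∈ extDual (gabidulin F k r b)) (d : ℕ) (hd : d < k) :
    ∑ j, (qPow F r ^ d) (b j) * e j = 0 := by
  rw [← he _ (twist_mem_gabidulin F r b hd)]
  exact Finset.sum_congr rfl fun _ _ => mul_comm _ _

theorem linearizedEval_injective_of_le {k m n : ℕ} {r : ℤ} {b : Fin n → K}
    (hm : Module.finrank F K = m) (hr : IsCoprime r (m : ℤ)) (hb : LinearIndependent F b)
    (hk : k ≤ n) : Function.Injective (linearizedEval F k r b) := by
  rw [← LinearMap.ker_eq_bot, LinearMap.ker_eq_bot']
  intro a ha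
  refine moore_right_injective (qPow F r) (qPow_fixed F hm hr) (fun i => b (Fin.castLE hk i)) a
    (hb.comp _ (Fin.castLE_injective hk)) fun i => ?_
  rw [← linearizedEval_apply F k r b a, ha, Pi.zero_apply]

variable {F}
variable {m n : ℕ}

theorem lt_rank_of_mem_extDual {k : ℕ} {r : ℤ} (α : Module.Basis (Fin m) F K)
    (hr : IsCoprime r (m : ℤ)) {b e : Fin n → K} (hb : LinearIndependent F b)
    (he : e ∈ extDual (gabidulin F k r b)) (h0 : e ≠ 0) : k < (matRep F α n e).rank := by
  by_contra hk
  refine h0 (eq_zero_of_rank_le (qPow F r)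
    (qPow_fixed F ((Module.finrank_eq_card_basis α).trans (Fintype.card_fin m)) hr) hb α
    (matRep F α n e) e (sum_matRep_smul α e) (not_lt.1 hk)
    (twist_sum_eq_zero_of_mem_extDual F he))

/-- If the coordinate matrix had a kernel of dimension at least k, the polynomial would vanish at k
independent combinations of the b_j, and `moore_right_injective` would make its k coefficients zero.
-/
theorem le_rank_add_of_mem_gabidulin {k : ℕ} {r : ℤ} (α : Module.Basis (Fin m) F K)
    (hr : IsCoprime r (m : ℤ)) {b c : Fin n → K} (hb : LinearIndependent F b)
    (hc : c ∈ gabidulin F k r b) (h0 : c ≠ 0) : n + 1 ≤ (matRep F α n c).rank + k := by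
  by_contra hk
  obtain ⟨a, rfl⟩ := hc
  set X := matRep F α n (linearizedEval F k r b a) with hX
  have hker : X.rank + Module.finrank F (LinearMap.ker X.mulVecLin) = n := by
    have := X.mulVecLin.finrank_range_add_finrank_ker
    rwa [Module.finrank_fin_fun] at this
  set B := Module.finBasis F (LinearMap.ker X.mulVecLin) with hB
  have hkl : k ≤ Module.finrank F (LinearMap.ker X.mulVecLin) := by omega
  let u : Fin k → Fin n → F := fun l => (B (Fin.castLE hkl l) : Fin n → F)
  have hu : LinearIndependent F u :=
    (B.linearIndependent.comp _ (Fin.castLE_injective hkl)).map' (Submodule.subtype _)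
      (Submodule.ker_subtype _)
  have hXu : ∀ l i, ∑ j, X i j * u l j = 0 := fun l i =>
    congrFun (LinearMap.mem_ker.1 (B (Fin.castLE hkl l)).2) i
  have ha : a = 0 := moore_right_injective (qPow F r)
    (qPow_fixed F ((Module.finrank_eq_card_basis α).trans (Fintype.card_fin m)) hr)
    (fun l => ∑ j, u l j • b j) a (linearIndependent_combination hb hu) fun l => by
    have h1 : ∑ j, u l j • linearizedEval F k r b a j = 0 := by
      calc ∑ j, u l j • linearizedEval F k r b a j
          = ∑ j, u l j • ∑ i, X i j • α i :=
            Finset.sum_congr rfl fun j _ => by rw [hX, ← sum_matRep_smul]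
        _ = ∑ i, (∑ j, X i j * u l j) • α i := by
            simp only [Finset.smul_sum, smul_smul, Finset.sum_smul]
            rw [Finset.sum_comm]
            simp only [mul_comm]
        _ = 0 := Finset.sum_eq_zero fun i _ => by rw [hXu, zero_smul]
    rw [← h1]
    simp only [linearizedEval_apply, map_sum, map_smul, Finset.mul_sum, Finset.smul_sum]
    rw [Finset.sum_comm]
    simp only [Algebra.mul_smul_comm]
  exact h0 (by rw [ha, map_zero])

theorem finrank_matCode_gabidulin {k : ℕ} {r : ℤ} (α : Module.Basis (Fin m) F K)
    (hr : IsCoprime r (m : ℤ)) {b : Fin n → K} (hb : LinearIndependent F b) (hk : k ≤ n) :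
    Module.finrank F (matCode F α ((gabidulin F k r b).restrictScalars F)) = m * k := by
  have hm := (Module.finrank_eq_card_basis α).trans (Fintype.card_fin m)
  have hinj := linearizedEval_injective_of_le F hm hr hb hk
  have h1 : Module.finrank K (gabidulin F k r b) = k := by
    rw [gabidulin, LinearMap.finrank_range_of_inj hinj, Module.finrank_fin_fun]
  have h2 := Module.finrank_mul_finrank F K (gabidulin F k r b)
  rw [hm, h1] at h2
  rw [h2]
  exact (Submodule.equivMapOfInjective _ (matRep_injective α) _).finrank_eq.symm

/-- The matrix of `g` is that of the `F`-linear map G with G(α_i) = g_i, so the product evaluates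
the composite polynomial, whose exponents i + l are at most s + t - 2. -/
theorem matRep_mul_mem {s t k : ℕ} {r : ℤ} (α : Module.Basis (Fin m) F K) {b : Fin n → K}
    {g : Fin m → K} {c : Fin n → K} (hg : g ∈ gabidulin F s r (fun i => α i))
    (hc : c ∈ gabidulin F t r b) (hk : s + t ≤ k + 1) :
    ∃ e ∈ gabidulin F k r b, matRep F α m g * matRep F α n c = matRep F α n e := by
  obtain ⟨x, rfl⟩ := hg
  obtain ⟨y, rfl⟩ := hc
  let G : K →ₗ[F] K := ∑ j, x j • (qPow F r ^ (j : ℕ) : K ≃ₐ[F] K).toLinearMap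
  have hG : ∀ z, G z = ∑ j, x j * (qPow F r ^ (j : ℕ)) z := fun z => by
    simp [G, LinearMap.sum_apply]
  refine ⟨fun j => G (linearizedEval F t r b y j), ?_, ?_⟩
  · have : (fun j => G (linearizedEval F t r b y j)) =
        ∑ i : Fin s, ∑ l : Fin t, (x i * (qPow F r ^ (i : ℕ)) (y l)) •
          fun j => (qPow F r ^ (i + l : ℕ)) (b j) := by
      funext j
      simp only [hG, linearizedEval_apply, map_sum, map_mul, Finset.sum_apply, Pi.smul_apply,
        smul_eq_mul, Finset.mul_sum, pow_add, AlgEquiv.mul_apply, mul_assoc]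
    rw [this]
    exact Submodule.sum_mem _ fun i _ => Submodule.sum_mem _ fun l _ =>
      Submodule.smul_mem _ _ (twist_mem_gabidulin F r b (by omega))
  · rw [← matRep_mul_matRep]
    congr 2
    funext i
    rw [hG, linearizedEval_apply]

/-- One padded vector serves all evaluation points; `phi` needs it at two of them. -/
theorem exists_linearizedEval_eq {t k : ℕ} (htk : t ≤ k) (a : Fin t → K) :
    ∃ a' : Fin k → K, ∀ (N : ℕ) (r : ℤ) (b : Fin N → K),
      linearizedEval F k r b a' = linearizedEval F t r b a := by
  obtain ⟨d, rfl⟩ := Nat.exists_eq_add_of_le htk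
  refine ⟨Fin.append a 0, fun N r b => funext fun i => ?_⟩
  rw [linearizedEval_apply, linearizedEval_apply, Fin.sum_univ_add]
  simp

theorem phi_linearizedEval {t : ℕ} (h : n ≤ m) (α : Module.Basis (Fin m) F K) (ht : t ≤ n)
    (a : Fin t → K) :
    phi F h α (linearizedEval F t 1 (firstVec F h α) a) =
      linearizedEval F t 1 (fun i => α i) a := by
  obtain ⟨a', ha'⟩ := exists_linearizedEval_eq (F := F) ht a
  rw [← ha', ← ha', phi, LinearMap.comp_apply]
  congr 1
  rw [LinearEquiv.coe_coe, LinearEquiv.symm_apply_eq]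
  rfl

theorem map_phi_gabidulin {t : ℕ} (h : n ≤ m) (α : Module.Basis (Fin m) F K) (ht : t ≤ n) :
    (gabidulin F t 1 (firstVec F h α)).map (phi F h α) = gabidulin F t 1 (fun i => α i) := by
  rw [gabidulin, gabidulin, ← LinearMap.range_comp]
  congr 1
  exact LinearMap.ext fun a => phi_linearizedEval h α ht a

theorem IsGabidulinTriple.eq_gabidulin {α : Module.Basis (Fin m) F K} {r : ℤ} {b : Fin n → K}
    {t : ℕ} {A : Submodule K (Fin n → K)} {B : Submodule K (Fin m → K)}
    {C : Submodule K (Fin n → K)} (h : IsGabidulinTriple F α r b t A B C) :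
    B = gabidulin F t r (fun i => α i) := by
  rcases h.eq_B with hB | ⟨rfl, hB⟩
  · exact hB
  · have := h.two_mul_t_le
    rw [hB, map_phi_gabidulin h.n_le_m α (by omega)]

theorem IsGabidulinTriple.isRECPTypeII {α α' : Module.Basis (Fin m) F K} {r : ℤ} {b : Fin n → K}
    {t : ℕ} {A : Submodule K (Fin n → K)} {B : Submodule K (Fin m → K)}
    {C : Submodule K (Fin n → K)} {D : Submodule F (Fin n → K)} (hd : IsDualBasis F α α')
    (h : IsGabidulinTriple F α r b t A B C) (hD : D ≤ C.restrictScalars F) :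
    IsRECPTypeII t (matCode F α (A.restrictScalars F)) (matCode F α (B.restrictScalars F))
      (matCode F α' D) := by
  have hB := h.eq_gabidulin
  have hA := h.eq_A
  have hC := h.eq_C
  have hnm := h.n_le_m
  have ht0 := h.t_pos
  have htn := h.two_mul_t_le
  have hr := h.coprime
  have hb := h.linearIndependent
  subst hA hB hC
  constructor
  · refine Submodule.span_le.2 ?_
    rintro _ ⟨_, ⟨g, hg, rfl⟩, _, ⟨c, hc, rfl⟩, rfl⟩ _ ⟨d, hdD, rfl⟩
    obtain ⟨e, he, hge⟩ := matRep_mul_mem (k := 2 * t) α hg hc (by omega)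
    rw [hge, sum_matRep_mul_matRep hd]
    have h0 : ∑ j, d j * e j = 0 := hD hdD e he
    simp only [mul_comm (e _), h0, map_zero]
  -- The dimension is m(t + 1), and m > 0 because 2t ≤ n ≤ m with t > 0.
  · rw [finrank_matCode_gabidulin α hr hb (by omega)]
    exact Nat.mul_lt_mul_of_pos_left (Nat.lt_succ_self t) (by omega)
  · refine lt_of_lt_of_le (Nat.cast_lt.2 (Nat.lt_succ_self t)) (le_minRankDist fun X hX h0 => ?_)
    obtain ⟨e, rfl⟩ := exists_matRep_eq α' X
    exact lt_rank_of_mem_extDual α' hr α.linearIndependent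
      (mem_extDual_of_matRep_mem_baseDual hd hX) fun he => h0 (by rw [he, map_zero])
  -- The two distances are at least n - t and 2t + 1, with sum n + t + 1.
  · have h1 : ((n - t : ℕ) : ℕ∞) ≤
        minRankDist (matCode F α ((gabidulin F (t + 1) r b).restrictScalars F)) := by
      refine le_minRankDist ?_
      rintro _ ⟨c, hc, rfl⟩ h0
      have := le_rank_add_of_mem_gabidulin α hr hb hc fun he => h0 (by rw [he, map_zero])
      omega
    have h2 : ((2 * t + 1 : ℕ) : ℕ∞) ≤ minRankDist (matCode F α' D) := by
      refine le_minRankDist ?_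
      rintro _ ⟨c, hc, rfl⟩ h0
      exact lt_rank_of_mem_extDual α' hr hb (hD hc) fun he => h0 (by rw [he, map_zero])
    refine lt_of_lt_of_le ?_ (add_le_add h1 h2)
    rw [← Nat.cast_add, Nat.cast_lt]
    omega

theorem exists_isGabidulinTriple {r : ℤ} {g : Fin n → K} {t k : ℕ} (α : Module.Basis (Fin m) F K)
    (hnm : n ≤ m) (hr : IsCoprime r (m : ℤ)) (hg : LinearIndependent F g) (ht : 0 < t)
    (hk : k + 2 * t ≤ n) :
    ∃ (b : Fin n → K) (A : Submodule K (Fin n → K)) (B : Submodule K (Fin m → K))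
      (C : Submodule K (Fin n → K)),
      IsGabidulinTriple F α r b t A B C ∧ gabidulin F k r g ≤ C := by
  classical
  -- The shift is chosen so that moving a twist l < 2t from `b` to `g` never leads to a negative
  -- twist of `w`.
  set w : Fin n → K := fun i => qPow F (-((2 * t - 1 : ℕ) : ℤ) * r) (g i) with hw
  have hwl : LinearIndependent F w :=
    hg.map' (qPow F (-((2 * t - 1 : ℕ) : ℤ) * r)).toLinearMap
      (LinearMap.ker_eq_bot.2 (qPow F _).injective)
  obtain ⟨b, hb0, hb⟩ : ∃ b : Fin n → K, b ≠ 0 ∧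
      ∀ d : Fin (n - 1), ∑ i, (qPow F r ^ (d : ℕ)) (w i) * b i = 0 := by
    let M : Matrix (Fin (n - 1)) (Fin n) K := Matrix.of fun d i => (qPow F r ^ (d : ℕ)) (w i)
    have : LinearMap.ker M.mulVecLin ≠ ⊥ :=
      LinearMap.ker_ne_bot_of_finrank_lt (by simp; omega)
    obtain ⟨b, hb, hb0⟩ := Submodule.exists_mem_ne_zero_of_ne_bot this
    exact ⟨b, hb0, fun d => congrFun hb d⟩
  have hbd : b ∈ extDual (gabidulin F (n - 1) r w) := by
    rintro _ ⟨a, rfl⟩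
    simp only [linearizedEval_apply, Finset.mul_sum]
    rw [Finset.sum_comm]
    refine Finset.sum_eq_zero fun d _ => ?_
    rw [← mul_zero (a d), ← hb d, Finset.mul_sum]
    exact Finset.sum_congr rfl fun i _ => by ring
  -- Rank greater than n - 1 is full column rank, that is, independence of the entries of `b`.
  have hrank := lt_rank_of_mem_extDual α hr hwl hbd hb0
  have hbl : LinearIndependent F b := by
    have h1 : LinearIndependent F (matRep F α n b).col := by
      rw [linearIndependent_iff_card_eq_finrank_span, Set.finrank, ← Matrix.rank_eq_finrank_span_cols,
        Fintype.card_fin]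
      have := (matRep F α n b).rank_le_width
      omega
    rw [Fintype.linearIndependent_iff] at h1 ⊢
    intro c hc i
    refine h1 c (funext fun l => ?_) i
    have := congrArg (fun x => α.repr x l) hc
    simpa [matRep, Finsupp.finsetSum_apply, Finset.sum_apply] using this
  refine ⟨b, _, _, _, ⟨hnm, ht, by omega, hr, hbl, rfl, Or.inl rfl, rfl⟩, ?_⟩
  rintro _ ⟨x, rfl⟩ _ ⟨y, rfl⟩
  simp only [linearizedEval, LinearMap.coe_mk, AddHom.coe_mk, Finset.sum_mul_sum]
  rw [Finset.sum_comm]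
  refine Finset.sum_eq_zero fun j _ => ?_
  rw [Finset.sum_comm]
  refine Finset.sum_eq_zero fun l _ => ?_
  -- The index lies between 0 and k + 2t - 2, which is at most n - 2.
  have h1 := hb ⟨2 * t - 1 + j - l, by omega⟩
  have h2 := congrArg (qPow F ((l : ℤ) * r)) h1
  rw [map_sum, map_zero] at h2
  have h3 : ∑ i, qPow F ((j : ℤ) * r) (g i) * qPow F ((l : ℤ) * r) (b i) = 0 := by
    rw [← h2]
    refine Finset.sum_congr rfl fun i _ => ?_
    rw [map_mul, hw, ← qPow_mul, ← qPow_add_apply, ← qPow_add_apply]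
    congr 3
    have : ((2 * t - 1 + j - l : ℕ) : ℤ) = (2 * t - 1 : ℕ) + j - l := by omega
    rw [this]
    ring
  rw [← mul_zero (x j * y l), ← h3, Finset.mul_sum]
  exact Finset.sum_congr rfl fun i _ => by ring

end Frobenius
-- Building computation trees; linear systems by elimination.
section Solvable

variable {Ω : Type w} {f : Ω → Type u} [∀ ω, Field (f ω)] {I O : Type}

/-- The problem `spec`, posed for all instances `ω ∈ P`, is solved by a computation tree of cost at
most `c` once the quantities in `S` have been stored in registers. -/
def Solvable (I : Type) (spec : ∀ ω, (O → f ω) → Prop) (c : ℕ) (S : Set (∀ ω, f ω)) (P : Set Ω) :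
    Prop :=
  ∀ (N : ℕ) (ρ : (∀ ω, f ω) → I ⊕ ℕ), (∀ q ∈ S, ∀ i, ρ q = Sum.inr i → i < N) →
    ∃ T : CompTree (I ⊕ ℕ) O, T.cost ≤ c ∧
      ∀ ω ∈ P, ∀ μ : I ⊕ ℕ → f ω, (∀ q ∈ S, μ (ρ q) = q ω) → spec ω (T.run μ)

variable {spec : ∀ ω, (O → f ω) → Prop} {c d : ℕ} {S S' : Set (∀ ω, f ω)} {P P' : Set Ω}

theorem Solvable.exists_tree (input : I → ∀ ω, f ω)
    (h : Solvable I spec c (Set.range input) Set.univ) :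
    ∃ T : CompTree (I ⊕ ℕ) O, T.cost ≤ c ∧
      ∀ ω, spec ω (T.run (Sum.elim (fun v => input v ω) fun _ => 0)) := by
  classical
  obtain ⟨T, hT, hrun⟩ := h 0
    -- The default register `Sum.inr 0` is never relied on, since only quantities in the range of
    -- `input` are claimed to be stored.
    (fun q => if hq : q ∈ Set.range input then Sum.inl hq.choose else Sum.inr 0) fun q hq i hi => by
      rw [dif_pos hq] at hi
      exact absurd hi Sum.inl_ne_inr
  refine ⟨T, hT, fun ω => hrun ω trivial _ fun q hq => ?_⟩
  rw [dif_pos hq, Sum.elim_inl, hq.choose_spec]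

theorem Solvable.mono (h : Solvable I spec c S P) (hc : c ≤ d) (hS : S ⊆ S') (hP : P' ⊆ P) :
    Solvable I spec d S' P' := fun N ρ hρ => by
  obtain ⟨T, hT, hrun⟩ := h N ρ fun q hq => hρ q (hS hq)
  exact ⟨T, hT.trans hc, fun ω hω μ hμ => hrun ω (hP hω) μ fun q hq => hμ q (hS hq)⟩

/-- This closes branches that no instance can reach. -/
theorem Solvable.of_forall_notMem (hP : ∀ ω, ω ∉ P) : Solvable I spec c S P := fun _ _ _ =>
  ⟨.output fun _ => Sum.inr 0, Nat.zero_le _, fun ω hω => absurd hω (hP ω)⟩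

theorem Solvable.output (out : O → ∀ ω, f ω) (hout : ∀ o, out o ∈ S)
    (h : ∀ ω ∈ P, spec ω fun o => out o ω) : Solvable I spec c S P := fun _ ρ _ =>
  ⟨.output fun o => ρ (out o), Nat.zero_le _, fun ω hω μ hμ => by
    have : CompTree.run (.output fun o => ρ (out o)) μ = fun o => out o ω :=
      funext fun o => hμ _ (hout o)
    rw [this]
    exact h ω hω⟩

theorem Solvable.branch {q : ∀ ω, f ω} (hq : q ∈ S) (h0 : Solvable I spec c S (P ∩ {ω | q ω = 0}))
    (h1 : Solvable I spec c S (P ∩ {ω | q ω ≠ 0})) : Solvable I spec (c + 1) S P := fun N ρ hρ => by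
  obtain ⟨T, hT, hrun⟩ := h0 N ρ hρ
  obtain ⟨T', hT', hrun'⟩ := h1 N ρ hρ
  refine ⟨.branch (ρ q) T T', Nat.succ_le_succ (max_le hT hT'), fun ω hω μ hμ => ?_⟩
  rw [CompTree.run, hμ q hq]
  split_ifs with hz
  · exact hrun ω ⟨hω, hz⟩ μ hμ
  · exact hrun' ω ⟨hω, hz⟩ μ hμ

/-- The bound `N` on the work registers in use makes register `N` fresh, so the new value overwrites
nothing in `S`. -/
theorem Solvable.assign {q : ∀ ω, f ω} (hq : ∀ ρ : (∀ ω, f ω) → I ⊕ ℕ, ∃ op : ArithOp (I ⊕ ℕ),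
      ∀ ω, ∀ μ : I ⊕ ℕ → f ω, (∀ q ∈ S, μ (ρ q) = q ω) → op.eval μ = q ω)
    (h : Solvable I spec c (insert q S) P) : Solvable I spec (c + 1) S P := fun N ρ hρ => by
  classical
  obtain ⟨op, hop⟩ := hq ρ
  obtain ⟨T, hT, hrun⟩ := h (N + 1) (Function.update ρ q (Sum.inr N)) fun q' hq' i hi => by
    by_cases hqq : q' = q
    · rw [hqq, Function.update_self] at hi
      exact Sum.inr_injective hi ▸ Nat.lt_succ_self N
    · rw [Function.update_of_ne hqq] at hi
      exact (hρ q' (hq'.resolve_left hqq) i hi).trans (Nat.lt_succ_self N)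
  refine ⟨.assign (Sum.inr N) op T, Nat.succ_le_succ hT, fun ω hω μ hμ => ?_⟩
  refine hrun ω hω _ fun q' hq' => ?_
  by_cases hqq : q' = q
  · rw [hqq, Function.update_self, hop ω μ hμ]
    exact @Function.update_self _ _ (_) _ _ _
  · have hS := hq'.resolve_left hqq
    rw [Function.update_of_ne hqq, ← hμ q' hS]
    exact @Function.update_of_ne _ _ (_) _ _ (fun hN => lt_irrefl N (hρ q' hS N hN)) _ _

/-- The quantity can be computed from the quantities in `S` with the given number of field
operations. -/
inductive Computable (S : Set (∀ ω, f ω)) : ℕ → (∀ ω, f ω) → Prop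
  | mem {q : ∀ ω, f ω} : q ∈ S → Computable S 0 q
  | zero : Computable S 1 fun _ => 0
  | one : Computable S 1 fun _ => 1
  | add {c d : ℕ} {x y : ∀ ω, f ω} : Computable S c x → Computable S d y →
      Computable S (c + d + 1) fun ω => x ω + y ω
  | sub {c d : ℕ} {x y : ∀ ω, f ω} : Computable S c x → Computable S d y →
      Computable S (c + d + 1) fun ω => x ω - y ω
  | mul {c d : ℕ} {x y : ∀ ω, f ω} : Computable S c x → Computable S d y →
      Computable S (c + d + 1) fun ω => x ω * y ω
  | inv {c : ℕ} {x : ∀ ω, f ω} : Computable S c x → Computable S (c + 1) fun ω => (x ω)⁻¹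

theorem Computable.sum {ι : Type*} [Fintype ι] {q : ι → ∀ ω, f ω}
    (hq : ∀ i, Computable S c (q i)) :
    Computable S (Fintype.card ι * (c + 1) + 1) fun ω => ∑ i, q i ω := by
  classical
  have : ∀ s : Finset ι, Computable S (s.card * (c + 1) + 1) fun ω => ∑ i ∈ s, q i ω := by
    intro s
    induction s using Finset.induction_on with
    | empty => simpa using Computable.zero
    | insert a s ha ih =>
      simp only [Finset.sum_insert ha, Finset.card_insert_of_notMem ha]
      have := (hq a).add ih
      rwa [show c + (s.card * (c + 1) + 1) + 1 = (s.card + 1) * (c + 1) + 1 by ring] at this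
  exact this Finset.univ

theorem Solvable.compute {q : ∀ ω, f ω} (hq : Computable S d q) (hS : S ⊆ S')
    (h : Solvable I spec c (insert q S') P) : Solvable I spec (c + d) S' P := by
  -- The common step for sum, difference and product: store both operands, then the result.
  have binary : ∀ {x y z : ∀ ω, f ω} {c₁ c₂ : ℕ} (op : I ⊕ ℕ → I ⊕ ℕ → ArithOp (I ⊕ ℕ)),
      (∀ ω, ∀ μ : I ⊕ ℕ → f ω, ∀ v v', μ v = x ω → μ v' = y ω → (op v v').eval μ = z ω) →
      (∀ {S' c}, S ⊆ S' → Solvable I spec c (insert x S') P → Solvable I spec (c + c₁) S' P) →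
      (∀ {S' c}, S ⊆ S' → Solvable I spec c (insert y S') P → Solvable I spec (c + c₂) S' P) →
      ∀ {S' c}, S ⊆ S' → Solvable I spec c (insert z S') P →
        Solvable I spec (c + (c₁ + c₂ + 1)) S' P := by
    intro x y z c₁ c₂ op hop hx hy S' c hS h
    rw [show c + (c₁ + c₂ + 1) = c + 1 + c₂ + c₁ by ring]
    refine hx hS (hy (hS.trans (Set.subset_insert _ _)) (Solvable.assign (fun ρ => ?_)
      (h.mono le_rfl (Set.insert_subset_insert ((Set.subset_insert _ _).trans
        (Set.subset_insert _ _))) subset_rfl)))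
    exact ⟨op (ρ x) (ρ y), fun ω μ hμ => hop ω μ _ _
      (hμ _ (Set.mem_insert_of_mem _ (Set.mem_insert _ _))) (hμ _ (Set.mem_insert _ _))⟩
  induction hq generalizing S' c with
  | mem hq => rwa [Set.insert_eq_of_mem (hS hq)] at h
  | zero => exact h.assign fun _ => ⟨.zero, fun _ _ _ => rfl⟩
  | one => exact h.assign fun _ => ⟨.one, fun _ _ _ => rfl⟩
  | add _ _ hx hy =>
    exact binary .add (fun ω μ v v' hv hv' => by rw [ArithOp.eval, hv, hv']) hx hy hS h
  | sub _ _ hx hy =>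
    exact binary .sub (fun ω μ v v' hv hv' => by rw [ArithOp.eval, hv, hv']) hx hy hS h
  | mul _ _ hx hy =>
    exact binary .mul (fun ω μ v v' hv hv' => by rw [ArithOp.eval, hv, hv']) hx hy hS h
  | @inv d x _ hx =>
    rw [show c + (d + 1) = c + 1 + d by ring]
    refine hx hS (Solvable.assign (fun ρ => ⟨.inv (ρ x), fun ω μ hμ => ?_⟩)
      (h.mono le_rfl (Set.insert_subset_insert (Set.subset_insert _ _)) subset_rfl))
    rw [ArithOp.eval, hμ _ (Set.mem_insert _ _)]

theorem Solvable.compute_family {ι : Type*} [Fintype ι] {q : ι → ∀ ω, f ω}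
    (hq : ∀ i, Computable S d (q i)) (h : Solvable I spec c (S ∪ Set.range q) P) :
    Solvable I spec (c + Fintype.card ι * d) S P := by
  classical
  have : ∀ (s : Finset ι) (S' : Set (∀ ω, f ω)), S ⊆ S' → (S ∪ Set.range q ⊆ S' ∪ q '' s) →
      Solvable I spec (c + s.card * d) S' P := by
    intro s
    induction s using Finset.induction_on with
    | empty =>
      intro S' _ hS'
      refine h.mono (by simp) (by simpa using hS') subset_rfl
    | insert a s ha ih =>
      intro S' hS hS'
      rw [Finset.card_insert_of_notMem ha, add_mul, one_mul, ← add_assoc]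
      refine Solvable.compute (hq a) hS (ih _ (hS.trans (Set.subset_insert _ _)) ?_)
      rw [Finset.coe_insert, Set.image_insert_eq, Set.union_insert] at hS'
      rwa [Set.insert_union]
  exact this Finset.univ S subset_rfl (by simp)

/-- Zero tests find a nonzero member of a family of quantities, if there is one. -/
theorem Solvable.branch_family {ι : Type*} [Fintype ι] {q : ι → ∀ ω, f ω} (hq : ∀ i, q i ∈ S)
    (h0 : Solvable I spec c S (P ∩ {ω | ∀ i, q i ω = 0}))
    (h1 : ∀ i, Solvable I spec c S (P ∩ {ω | q i ω ≠ 0})) :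
    Solvable I spec (c + Fintype.card ι) S P := by
  classical
  -- `s` is the set of indices still untested; all others are known to give zero.
  have : ∀ (s : Finset ι) (P' : Set Ω), P' ⊆ P → (∀ ω ∈ P', ∀ i ∉ s, q i ω = 0) →
      Solvable I spec (c + s.card) S P' := by
    intro s
    induction s using Finset.induction_on with
    | empty =>
      intro P' hP hz
      exact h0.mono (by simp) subset_rfl fun ω hω => ⟨hP hω, fun i => hz ω hω i (by simp)⟩
    | insert a s ha ih =>
      intro P' hP hz
      rw [Finset.card_insert_of_notMem ha, ← add_assoc]
      refine Solvable.branch (hq a) (ih _ (Set.inter_subset_left.trans hP) fun ω hω i hi => ?_)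
        ((h1 a).mono (Nat.le_add_right _ _) subset_rfl (Set.inter_subset_inter_left _ hP))
      by_cases hia : i = a
      · exact hia ▸ hω.2
      · exact hz ω hω.1 i (by simp [hia, hi])
  exact this Finset.univ P subset_rfl (by simp)

/-- The matrix `Z'` arises from `Z` by restricting its column space to the common kernel of `rows`:
it is annihilated by the rows and acts as the identity on the kernel as far as `Z` does. -/
structure Restricts {F : Type*} [Field F] {ι κ : Type*} [Fintype ι] (rows : κ → ι → F) (l : List κ)
    (Z Z' : ι → ι → F) : Prop where
  annihilates : ∀ a ∈ l, ∀ j, ∑ i, rows a i * Z' i j = 0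
  preserves : ∀ x : ι → F, (∀ j, ∑ i, x i * Z i j = 0) → ∀ j, ∑ i, x i * Z' i j = 0
  fixes : ∀ x : ι → F, (∀ a ∈ l, ∑ i, rows a i * x i = 0) → (∀ i, ∑ j, Z i j * x j = x i) →
    ∀ i, ∑ j, Z' i j * x j = x i

/-- The field `preserves` keeps a row that is already annihilated so during later eliminations. -/
theorem Restricts.cons {F : Type*} [Field F] {ι κ : Type*} [Fintype ι] {rows : κ → ι → F}
    {a : κ} {l : List κ} {Z Z₁ Z' : ι → ι → F} (h1 : Restricts rows [a] Z Z₁)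
    (h2 : Restricts rows l Z₁ Z') : Restricts rows (a :: l) Z Z' where
  annihilates a' ha' := by
    rcases List.mem_cons.1 ha' with rfl | ha'
    · exact h2.preserves _ (h1.annihilates _ (List.mem_singleton_self _))
    · exact h2.annihilates a' ha'
  preserves x hx := h2.preserves x (h1.preserves x hx)
  fixes x hx hZ := h2.fixes x (fun a' ha' => hx a' (List.mem_cons_of_mem _ ha'))
    (h1.fixes x (fun a' ha' => by
      rw [List.mem_singleton.1 ha']; exact hx a List.mem_cons_self) hZ)

theorem Restricts.of_eq_zero {F : Type*} [Field F] {ι κ : Type*} [Fintype ι] {rows : κ → ι → F}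
    {a : κ} {Z : ι → ι → F} (h : ∀ j, ∑ i, rows a i * Z i j = 0) : Restricts rows [a] Z Z where
  annihilates a' ha' := by rw [List.mem_singleton.1 ha']; exact h
  preserves _ hx := hx
  fixes _ _ hZ := hZ

/-- Multiples of column j₀ clear row a of the product. If Z x = x and row a kills x, then s · x = 0,
so the correction does not change Z x. -/
theorem Restricts.pivot {F : Type*} [Field F] {ι κ : Type*} [Fintype ι] {rows : κ → ι → F}
    {a : κ} {Z : ι → ι → F} {s : ι → F} (hs : ∀ j, s j = ∑ i, rows a i * Z i j) {j₀ : ι}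
    (h : s j₀ ≠ 0) : Restricts rows [a] Z fun i j => Z i j - Z i j₀ * (s j * (s j₀)⁻¹) := by
  have key : ∀ (x : ι → F) (j : ι), ∑ i, x i * (Z i j - Z i j₀ * (s j * (s j₀)⁻¹)) =
      ∑ i, x i * Z i j - (∑ i, x i * Z i j₀) * (s j * (s j₀)⁻¹) := fun x j => by
    simp only [mul_sub, Finset.sum_sub_distrib, Finset.sum_mul, mul_assoc]
  refine ⟨fun a' ha' j => ?_, fun x hx j => ?_, fun x hx hZ i => ?_⟩
  · rw [List.mem_singleton.1 ha', key, ← hs, ← hs]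
    field_simp
    ring
  · rw [key, hx, hx, zero_mul, sub_zero]
  · have hsx : ∑ j, s j * x j = 0 := by
      rw [← hx a (List.mem_singleton_self _)]
      simp only [hs, Finset.sum_mul]
      rw [Finset.sum_comm]
      refine Finset.sum_congr rfl fun i _ => ?_
      rw [← hZ i, Finset.mul_sum]
      exact Finset.sum_congr rfl fun j _ => mul_assoc _ _ _
    have : ∑ j, (Z i j - Z i j₀ * (s j * (s j₀)⁻¹)) * x j =
        ∑ j, Z i j * x j - Z i j₀ * (s j₀)⁻¹ * ∑ j, s j * x j := by
      simp only [sub_mul, Finset.sum_sub_distrib, Finset.mul_sum]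
      congr 1
      exact Finset.sum_congr rfl fun j _ => by ring
    rw [this, hsx, mul_zero, sub_zero, hZ]

/-- The number of operations that process one row of a system of equations in `L` unknowns. -/
def rowCost (L : ℕ) : ℕ := L * L * 4 + L + L * (L * 2 + 1)

/-- The number of operations that solve a homogeneous system of `N` equations in `L` unknowns. -/
def kernelCost (N L : ℕ) : ℕ := L * L + N * rowCost L + L * L

/-- The pivot, and hence the final matrix, depends on the branch taken; therefore the continuation
must accept any `S'`, `P'` and `Z'`. -/
theorem Solvable.restrict_kernel {ι κ : Type} [Fintype ι] (rows : κ → ι → ∀ ω, f ω)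
    (l : List κ) : ∀ {S : Set (∀ ω, f ω)} {P : Set Ω} (Z : ι → ι → ∀ ω, f ω),
    (∀ a i, rows a i ∈ S) → (∀ i j, Z i j ∈ S) →
    (∀ S' P' (Z' : ι → ι → ∀ ω, f ω), S ⊆ S' → P' ⊆ P → (∀ i j, Z' i j ∈ S') →
      (∀ ω ∈ P', Restricts (fun a i => rows a i ω) l (fun i j => Z i j ω) fun i j => Z' i j ω) →
      Solvable I spec c S' P') →
    Solvable I spec (c + l.length * rowCost (Fintype.card ι)) S P := by
  induction l with
  | nil =>
    intro S P Z _ hZ h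
    simpa using h S P Z subset_rfl subset_rfl hZ fun ω _ => ⟨by simp, fun _ hx => hx, fun _ _ hx => hx⟩
  | cons a l ih =>
    intro S P Z hrows hZ h
    set s : ι → ∀ ω, f ω := fun j ω => ∑ i, rows a i ω * Z i j ω with hs
    have hcost : c + (a :: l).length * rowCost (Fintype.card ι) =
        c + l.length * rowCost (Fintype.card ι) + Fintype.card (ι × ι) * 4 + Fintype.card ι +
          Fintype.card ι * (Fintype.card ι * 2 + 1) := by
      rw [List.length_cons, add_mul, one_mul]
      simp only [rowCost, Fintype.card_prod]
      ring
    rw [hcost]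
    have hsc : ∀ j, Computable S (Fintype.card ι * 2 + 1) (s j) := fun j =>
      Computable.sum fun i => (Computable.mem (hrows a i)).mul (Computable.mem (hZ i j))
    refine Solvable.compute_family hsc (Solvable.branch_family (q := s)
      (fun i => Or.inr ⟨i, rfl⟩) ?_ fun j₀ => ?_)
    · refine (ih Z (fun a i => Or.inl (hrows a i)) (fun i j => Or.inl (hZ i j))
        fun S' P' Z' hS hP hZ' hR => ?_).mono (Nat.le_add_right _ _) subset_rfl subset_rfl
      exact h S' P' Z' (Set.subset_union_left.trans hS) (hP.trans Set.inter_subset_left) hZ'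
        fun ω hω => Restricts.cons (Restricts.of_eq_zero (hP hω).2) (hR ω hω)
    · set Z₁ : ι → ι → ∀ ω, f ω := fun i j ω => Z i j ω - Z i j₀ ω * (s j ω * (s j₀ ω)⁻¹) with hZ₁
      have hc : ∀ v : ι × ι, Computable (S ∪ Set.range s) 4 (Z₁ v.1 v.2) := fun v => by
        have hm : ∀ j, Computable (S ∪ Set.range s) 0 (s j) := fun j => .mem (Or.inr ⟨j, rfl⟩)
        have hz : ∀ i j, Computable (S ∪ Set.range s) 0 (Z i j) := fun i j => .mem (Or.inl (hZ i j))
        exact (hz v.1 v.2).sub ((hz v.1 j₀).mul ((hm v.2).mul (hm j₀).inv))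
      refine Solvable.compute_family hc (ih Z₁ (fun a i => Or.inl (Or.inl (hrows a i)))
        (fun i j => Or.inr ⟨(i, j), rfl⟩) fun S' P' Z' hS hP hZ' hR => ?_)
      exact h S' P' Z' ((Set.subset_union_left.trans Set.subset_union_left).trans hS)
        (hP.trans Set.inter_subset_left) hZ'
        fun ω hω => Restricts.cons (Restricts.pivot (fun j => rfl) (hP hω).2) (hR ω hω)

/-- A nonzero solution of a homogeneous system of linear equations can be computed. -/
theorem Solvable.kernel {ι κ : Type} [Fintype ι] [Fintype κ] (rows : κ → ι → ∀ ω, f ω)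
    (hrows : ∀ a i, rows a i ∈ S)
    (hker : ∀ ω ∈ P, ∃ x : ι → f ω, x ≠ 0 ∧ ∀ a, ∑ i, rows a i ω * x i = 0)
    (h : ∀ S' P' (x : ι → ∀ ω, f ω), S ⊆ S' → P' ⊆ P → (∀ i, x i ∈ S') →
      (∀ ω ∈ P', (fun i => x i ω) ≠ 0 ∧ ∀ a, ∑ i, rows a i ω * x i ω = 0) →
      Solvable I spec c S' P') :
    Solvable I spec (c + kernelCost (Fintype.card κ) (Fintype.card ι)) S P := by
  classical
  set Z : ι × ι → ∀ ω, f ω := fun v _ => if v.1 = v.2 then 1 else 0 with hZ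
  have hZc : ∀ v, Computable S 1 (Z v) := fun v => by
    by_cases hv : v.1 = v.2
    · simpa [hZ, hv] using Computable.one
    · simpa [hZ, hv] using Computable.zero
  have hcost : c + kernelCost (Fintype.card κ) (Fintype.card ι) = c + Fintype.card (ι × ι) +
      (Finset.univ : Finset κ).toList.length * rowCost (Fintype.card ι) +
      Fintype.card (ι × ι) * 1 := by
    simp only [kernelCost, Fintype.card_prod, Finset.length_toList, Finset.card_univ]
    ring
  rw [hcost]
  refine Solvable.compute_family hZc (Solvable.restrict_kernel rows _ (fun i j => Z (i, j))
    (fun a i => Or.inl (hrows a i)) (fun i j => Or.inr ⟨(i, j), rfl⟩)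
    fun S' P' Z' hS hP hZ' hR => ?_)
  -- Elimination started from the identity, so `Z'` fixes every solution and cannot vanish; the
  -- column of a nonzero entry is a nonzero solution.
  refine Solvable.branch_family (q := fun v : ι × ι => Z' v.1 v.2) (fun v => hZ' _ _) ?_ fun v => ?_
  · refine Solvable.of_forall_notMem ?_
    rintro ω ⟨hω, hzero⟩
    obtain ⟨x, hx0, hx⟩ := hker ω (hP hω)
    refine hx0 (funext fun i => ?_)
    rw [← (hR ω hω).fixes x (fun a _ => hx a) (fun i => by simp [hZ]) i]
    exact Finset.sum_eq_zero fun j _ => by rw [hzero (i, j), zero_mul]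
  · refine h S' _ (fun i => Z' i v.2) (Set.subset_union_left.trans hS)
      (Set.inter_subset_left.trans hP) (fun i => hZ' _ _) fun ω hω => ⟨fun h0 => ?_, fun a => ?_⟩
    · exact hω.2 (congrFun h0 v.1)
    · exact (hR ω hω.1).annihilates a (by simp) v.2

end Solvable
-- Correctness of decoding with a type II pair.
section Locator

variable {F : Type u} [Field F] {m n p s k t : ℕ}

/-- Write E = P Q, where Q has rank(E) rows. The map Y ↦ Q Yᵀ goes to a space of dimension at most
mt, so it has a kernel on `A`. -/
theorem exists_locator {A : Submodule F (Matrix (Fin m) (Fin n) F)}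
    (hA : m * t < Module.finrank F A) {E : Matrix (Fin m) (Fin n) F} (hE : E.rank ≤ t) :
    ∃ Y ∈ A, Y ≠ 0 ∧ E * Y.transpose = 0 := by
  obtain ⟨P, Q, -, hPQ⟩ := exists_row_factorization E
  have hEPQ : E = Matrix.of P * Matrix.of Q := by
    ext i j
    exact hPQ i j
  let L : A →ₗ[F] Matrix (Fin E.rank) (Fin m) F :=
    { toFun := fun Y => Matrix.of Q * (Y : Matrix (Fin m) (Fin n) F).transpose
      map_add' := fun Y Y' => by simp [Matrix.mul_add]
      map_smul' := fun a Y => by simp }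
  have hL : LinearMap.ker L ≠ ⊥ := by
    refine LinearMap.ker_ne_bot_of_finrank_lt (lt_of_le_of_lt ?_ hA)
    rw [Module.finrank_matrix, Module.finrank_self, mul_one, Fintype.card_fin, Fintype.card_fin,
      mul_comm]
    exact Nat.mul_le_mul_left m hE
  obtain ⟨Y, hY, hY0⟩ := Submodule.exists_mem_ne_zero_of_ne_bot hL
  refine ⟨Y, Y.2, fun h => hY0 (Subtype.ext h), ?_⟩
  rw [hEPQ, Matrix.mul_assoc, show Matrix.of Q * (Y : Matrix (Fin m) (Fin n) F).transpose = 0 from hY,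
    Matrix.mul_zero]

theorem IsBasisOf.exists_sum_eq {g : Fin k → Matrix (Fin m) (Fin n) F}
    {C : Submodule F (Matrix (Fin m) (Fin n) F)} (hg : IsBasisOf g C)
    {X : Matrix (Fin m) (Fin n) F} (hX : X ∈ C) : ∃ x : Fin k → F, ∑ h, x h • g h = X := by
  rw [← hg.2] at hX
  exact (Submodule.mem_span_range_iff_exists_fun F).1 hX

theorem IsBasisOf.sum_mem {g : Fin k → Matrix (Fin m) (Fin n) F}
    {C : Submodule F (Matrix (Fin m) (Fin n) F)} (hg : IsBasisOf g C) (x : Fin k → F) :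
    ∑ h, x h • g h ∈ C := by
  rw [← hg.2]
  exact Submodule.sum_mem _ fun h _ => Submodule.smul_mem _ _ (Submodule.subset_span ⟨h, rfl⟩)

/-- The base product with a fixed matrix, as a linear form. -/
def basePairing (Y : Matrix (Fin m) (Fin n) F) : Matrix (Fin m) (Fin n) F →ₗ[F] F where
  toFun X := ∑ i, ∑ j, X i j * Y i j
  map_add' X X' := by simp [add_mul, Finset.sum_add_distrib]
  map_smul' a X := by simp [mul_assoc, Finset.mul_sum]

theorem basePairing_mul (B : Matrix (Fin m) (Fin m) F) (Y E : Matrix (Fin m) (Fin n) F) :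
    basePairing E (B * Y) = basePairing B (E * Y.transpose) := by
  change ∑ i, ∑ j, (B * Y) i j * E i j = ∑ i, ∑ j, (E * Y.transpose) i j * B i j
  simp only [Matrix.mul_apply, Matrix.transpose_apply, Finset.sum_mul]
  refine Finset.sum_congr rfl fun i _ => ?_
  rw [Finset.sum_comm]
  exact Finset.sum_congr rfl fun j _ => Finset.sum_congr rfl fun l _ => by ring

theorem basePairing_add (X Y Z : Matrix (Fin m) (Fin n) F) :
    basePairing (X + Y) Z = basePairing X Z + basePairing Y Z := by
  change ∑ i, ∑ j, Z i j * (X + Y) i j = ∑ i, ∑ j, Z i j * X i j + ∑ i, ∑ j, Z i j * Y i j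
  simp [mul_add, Finset.sum_add_distrib]

theorem sum_basePairing_mul (R : Matrix (Fin m) (Fin n) F) (B : Matrix (Fin m) (Fin m) F)
    (g : Fin p → Matrix (Fin m) (Fin n) F) (x : Fin p → F) :
    ∑ i, basePairing R (B * g i) * x i = basePairing R (B * ∑ i, x i • g i) := by
  rw [Matrix.mul_sum, map_sum]
  exact Finset.sum_congr rfl fun i _ => by
    rw [Matrix.mul_smul, map_smul, smul_eq_mul, mul_comm]

variable {A C : Submodule F (Matrix (Fin m) (Fin n) F)} {B : Submodule F (Matrix (Fin m) (Fin m) F)}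
  {gA : Fin p → Matrix (Fin m) (Fin n) F} {gB : Fin s → Matrix (Fin m) (Fin m) F}
  {gC : Fin k → Matrix (Fin m) (Fin n) F} {X E : Matrix (Fin m) (Fin n) F}

/-- The codeword drops out by orthogonality, so these pairings are syndromes: computable from the
received matrix, yet dependent on the error alone. -/
theorem IsRECPTypeII.basePairing_add_eq (h : IsRECPTypeII t A B C) {Z : Matrix (Fin m) (Fin m) F}
    (hZ : Z ∈ B) {Y : Matrix (Fin m) (Fin n) F} (hY : Y ∈ A) (hX : X ∈ C) :
    basePairing (X + E) (Z * Y) = basePairing Z (E * Y.transpose) := by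
  have h0 : basePairing X (Z * Y) = 0 := h.mul_le (Submodule.subset_span ⟨Z, hZ, Y, hY, rfl⟩) X hX
  rw [basePairing_add, h0, zero_add, basePairing_mul]

theorem IsRECPTypeII.exists_locator_coeff (h : IsRECPTypeII t A B C) (hA : IsBasisOf gA A)
    (hB : IsBasisOf gB B) (hX : X ∈ C) (hE : E.rank ≤ t) :
    ∃ x : Fin p → F, x ≠ 0 ∧ ∀ a, ∑ i, basePairing (X + E) (gB a * gA i) * x i = 0 := by
  obtain ⟨Y, hY, hY0, hEY⟩ := exists_locator h.dim_gt hE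
  obtain ⟨x, rfl⟩ := hA.exists_sum_eq hY
  refine ⟨x, fun hx => hY0 (by simp [hx]), fun a => ?_⟩
  have ha : gB a ∈ B := hB.2 ▸ Submodule.subset_span ⟨a, rfl⟩
  rw [sum_basePairing_mul, h.basePairing_add_eq ha hY hX, hEY, map_zero]

/-- The equations place E Yᵀ in the dual of `B`, whose nonzero members have rank greater than t,
while E Yᵀ has rank at most t. -/
theorem IsRECPTypeII.mul_transpose_eq_zero (h : IsRECPTypeII t A B C) (hA : IsBasisOf gA A)
    (hB : IsBasisOf gB B) (hX : X ∈ C) (hE : E.rank ≤ t) {x : Fin p → F}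
    (hx : ∀ a, ∑ i, basePairing (X + E) (gB a * gA i) * x i = 0) :
    E * (∑ i, x i • gA i).transpose = 0 := by
  set Y := ∑ i, x i • gA i with hY
  by_contra h0
  have hmem : E * Y.transpose ∈ baseDual B := by
    intro Z hZ
    obtain ⟨y, rfl⟩ := hB.exists_sum_eq hZ
    have h1 : ∀ a, basePairing (X + E) (gB a * Y) = 0 := fun a => by
      rw [hY, ← sum_basePairing_mul, hx]
    change basePairing (∑ a, y a • gB a) (E * Y.transpose) = 0
    rw [← h.basePairing_add_eq hZ (hA.sum_mem x) hX, Matrix.sum_mul, map_sum]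
    exact Finset.sum_eq_zero fun a _ => by rw [Matrix.smul_mul, map_smul, h1, smul_zero]
  have h2 := h.dual_dist.trans_le (minRankDist_le hmem h0)
  rw [Nat.cast_lt] at h2
  exact absurd ((Matrix.rank_mul_le_left E Y.transpose).trans hE) (not_le.2 h2)

/-- X Yᵀ = 0 forces rank X + rank Y ≤ n, against the distance condition. -/
theorem IsRECPTypeII.eq_zero_of_mul_transpose (h : IsRECPTypeII t A B C)
    {Y : Matrix (Fin m) (Fin n) F} (hY : Y ∈ A) (hY0 : Y ≠ 0) (hX : X ∈ C)
    (hXY : X * Y.transpose = 0) : X = 0 := by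
  by_contra hX0
  have h1 := add_le_add (minRankDist_le hY hY0) (minRankDist_le hX hX0)
  have h2 := h.dist_add.trans_le h1
  rw [← Nat.cast_add, Nat.cast_lt] at h2
  have h3 := Matrix.rank_add_rank_le_card_of_mul_eq_zero hXY
  rw [Matrix.rank_transpose, Fintype.card_fin] at h3
  omega

theorem IsBasisOf.ne_zero (hA : IsBasisOf gA A) {x : Fin p → F} (hx : x ≠ 0) :
    ∑ i, x i • gA i ≠ 0 := fun h =>
  hx (funext (Fintype.linearIndependent_iff.1 hA.1 x h))

/-- The system for the codeword is made homogeneous by giving the received matrix a coefficient of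
its own; -1 is its value at the true solution. -/
theorem IsRECPTypeII.exists_codeword_coeff (hC : IsBasisOf gC C) (hX : X ∈ C)
    {Y : Matrix (Fin m) (Fin n) F} (hEY : E * Y.transpose = 0) :
    ∃ z : Fin k → F, (∑ a, z a • gC a + (-1 : F) • (X + E)) * Y.transpose = 0 := by
  obtain ⟨z, rfl⟩ := hC.exists_sum_eq hX
  refine ⟨z, ?_⟩
  rw [neg_one_smul, ← sub_eq_add_neg, sub_add_cancel_left, Matrix.neg_mul, hEY, neg_zero]

/-- For any nonzero solution, ∑ z_a g_a + z₀ X is a codeword killed by Yᵀ, hence zero; independence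
of the g_a excludes z₀ = 0. -/
theorem IsRECPTypeII.codeword_eq (h : IsRECPTypeII t A B C) (hC : IsBasisOf gC C) (hX : X ∈ C)
    {Y : Matrix (Fin m) (Fin n) F} (hY : Y ∈ A) (hY0 : Y ≠ 0) (hEY : E * Y.transpose = 0)
    {z₀ : F} {z : Fin k → F} (hz0 : z₀ = 0 → z ≠ 0)
    (hz : (∑ a, z a • gC a + z₀ • (X + E)) * Y.transpose = 0) :
    ∑ a, (0 - z a * z₀⁻¹) • gC a = X := by
  have hW : ∑ a, z a • gC a + z₀ • X = 0 := by
    refine h.eq_zero_of_mul_transpose hY hY0 (C.add_mem (hC.sum_mem z) (C.smul_mem _ hX)) ?_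
    rwa [smul_add, ← add_assoc, Matrix.add_mul, Matrix.smul_mul _ E, hEY, smul_zero,
      add_zero] at hz
  have hne : z₀ ≠ 0 := fun h0 => by
    rw [h0, zero_smul, add_zero] at hW
    exact hC.ne_zero (hz0 h0) hW
  have h1 : ∑ a, (0 - z a * z₀⁻¹) • gC a = -(z₀⁻¹ • ∑ a, z a • gC a) := by
    rw [Finset.smul_sum, ← Finset.sum_neg_distrib]
    exact Finset.sum_congr rfl fun a _ => by
      rw [zero_sub, neg_smul, smul_smul, mul_comm]
  rw [h1, eq_neg_of_add_eq_zero_left hW, smul_neg, neg_neg, smul_smul, inv_mul_cancel₀ hne, one_smul]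

end Locator

/-! ### The decoding tree. -/

section Decoding

/-- A decoding problem for a code with a rank error-correcting pair of type II, with the received
matrix `X + E`. -/
structure DecodingInstance (m n p s k : ℕ) : Type (u + 1) where
  F : Type u
  [field : Field F]
  t : ℕ
  A : Submodule F (Matrix (Fin m) (Fin n) F)
  B : Submodule F (Matrix (Fin m) (Fin m) F)
  C : Submodule F (Matrix (Fin m) (Fin n) F)
  gA : Fin p → Matrix (Fin m) (Fin n) F
  gB : Fin s → Matrix (Fin m) (Fin m) F
  gC : Fin k → Matrix (Fin m) (Fin n) F
  X : Matrix (Fin m) (Fin n) F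
  E : Matrix (Fin m) (Fin n) F
  isRECP : IsRECPTypeII t A B C
  basis_A : IsBasisOf gA A
  basis_B : IsBasisOf gB B
  basis_C : IsBasisOf gC C
  mem : X ∈ C
  rank_le : E.rank ≤ t

attribute [instance] DecodingInstance.field

variable {m n p s k : ℕ}

/-- The contents of the input registers. -/
def DecodingInstance.input (v : DecoderInput m n p s k) (ω : DecodingInstance.{u} m n p s k) :
    ω.F :=
  match v with
  | .genA h i j => ω.gA h i j
  | .genB h i j => ω.gB h i j
  | .genD h i j => ω.gC h i j
  | .received i j => (ω.X + ω.E) i j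

/-- The number of operations of the decoder for type II pairs. -/
def decoderCost (m n p s k : ℕ) : ℕ :=
  m * n * (k * 6 + 1) + kernelCost (m * m) (k + 1) + m * m * (k + 1) * (n * 2 + 1) +
    m * n * (p * 2 + 1) + kernelCost s p + s * p * (m * (n * (m * 2 + 3) + 2) + 1)

theorem solvable_decoding : Solvable (DecoderInput m n p s k)
    (fun (ω : DecodingInstance.{u} m n p s k) (out : Fin m × Fin n → ω.F) =>
      ∀ i j, out (i, j) = ω.X i j)
    (decoderCost m n p s k)
    (Set.range DecodingInstance.input) Set.univ := by
  set S : Set (∀ ω : DecodingInstance.{u} m n p s k, ω.F) := Set.range DecodingInstance.input with hS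
  have hinA : ∀ h i j, Computable S 0 fun ω => ω.gA h i j :=
    fun h i j => .mem ⟨.genA h i j, rfl⟩
  have hinB : ∀ h i j, Computable S 0 fun ω => ω.gB h i j :=
    fun h i j => .mem ⟨.genB h i j, rfl⟩
  have hinC : ∀ h i j, (fun ω : DecodingInstance.{u} m n p s k => ω.gC h i j) ∈ S :=
    fun h i j => ⟨.genD h i j, rfl⟩
  have hinR : ∀ i j, (fun ω : DecodingInstance.{u} m n p s k => (ω.X + ω.E) i j) ∈ S :=
    fun i j => ⟨.received i j, rfl⟩
  -- the equations of the locator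
  set r₁ : Fin s × Fin p → ∀ ω : DecodingInstance.{u} m n p s k, ω.F := fun v ω =>
    basePairing (ω.X + ω.E) (ω.gB v.1 * ω.gA v.2) with hr₁
  have hc₁ : ∀ v, Computable S (m * (n * (m * 2 + 3) + 2) + 1) (r₁ v) := fun v => by
    have h1 : ∀ i j, Computable S (m * (0 + 0 + 1 + 1) + 1 + 0 + 1)
        fun ω => (∑ l, ω.gB v.1 i l * ω.gA v.2 l j) * (ω.X + ω.E) i j := fun i j => by
      have h0 := Computable.sum fun l => (hinB v.1 i l).mul (hinA v.2 l j)
      rw [Fintype.card_fin] at h0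
      exact h0.mul (.mem (hinR i j))
    have h2 := Computable.sum fun i => Computable.sum fun j => h1 i j
    rwa [Fintype.card_fin, Fintype.card_fin,
      show m * (n * (m * (0 + 0 + 1 + 1) + 1 + 0 + 1 + 1) + 1 + 1) + 1 =
        m * (n * (m * 2 + 3) + 2) + 1 by ring] at h2
  have hcard₁ : s * p = Fintype.card (Fin s × Fin p) := by simp
  rw [decoderCost, hcard₁]
  refine Solvable.compute_family hc₁ ?_
  have hk₁ := Solvable.kernel (Ω := DecodingInstance.{u} m n p s k) (f := fun ω => ω.F)
    (I := DecoderInput m n p s k) (S := S ∪ Set.range r₁) (P := Set.univ)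
    (spec := fun ω (out : Fin m × Fin n → ω.F) => ∀ i j, out (i, j) = ω.X i j)
    (c := m * n * (k * 6 + 1) + kernelCost (m * m) (k + 1) + m * m * (k + 1) * (n * 2 + 1) +
      m * n * (p * 2 + 1)) (fun a i => r₁ (a, i)) (fun a i => Or.inr ⟨(a, i), rfl⟩)
    (fun ω _ => ω.isRECP.exists_locator_coeff ω.basis_A ω.basis_B ω.mem ω.rank_le)
  rw [Fintype.card_fin, Fintype.card_fin] at hk₁
  refine hk₁ fun S₂ P₂ x hS₂ _ hx hxP => ?_
  -- the locator
  set Y : Fin m × Fin n → ∀ ω : DecodingInstance.{u} m n p s k, ω.F := fun v ω =>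
    ∑ h, x h ω * ω.gA h v.1 v.2 with hY
  have hSS₂ : S ⊆ S₂ := Set.subset_union_left.trans hS₂
  have hcY : ∀ v, Computable S₂ (p * 2 + 1) (Y v) := fun v => by
    have h1 := Computable.sum fun h => (Computable.mem (hx h)).mul
      (Computable.mem (hSS₂ ⟨.genA h v.1 v.2, rfl⟩))
    rwa [Fintype.card_fin] at h1
  have hYeq : ∀ ω, (∑ h, x h ω • ω.gA h) = Matrix.of fun i j => Y (i, j) ω := fun ω => by
    ext i j
    simp [hY, Matrix.sum_apply]
  have hcardY : m * n = Fintype.card (Fin m × Fin n) := by simp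
  nth_rewrite 2 [hcardY]
  refine Solvable.compute_family hcY ?_
  -- the equations of the codeword
  set G : Option (Fin k) → Fin m → Fin n → ∀ ω : DecodingInstance.{u} m n p s k, ω.F :=
    fun o i l ω => o.elim ((ω.X + ω.E) i l) fun h => ω.gC h i l with hG
  have hGS : ∀ o i l, G o i l ∈ S := fun o i l => by
    cases o with
    | none => exact hinR i l
    | some h => exact hinC h i l
  set r₂ : (Fin m × Fin m) × Option (Fin k) → ∀ ω : DecodingInstance.{u} m n p s k, ω.F :=
    fun v ω => ∑ l, G v.2 v.1.1 l ω * Y (v.1.2, l) ω with hr₂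
  have hc₂ : ∀ v, Computable (S₂ ∪ Set.range Y) (n * 2 + 1) (r₂ v) := fun v => by
    have h1 := Computable.sum fun l => (Computable.mem (S := S₂ ∪ Set.range Y)
      (Or.inl (hSS₂ (hGS v.2 v.1.1 l)))).mul
      (Computable.mem (Or.inr ⟨(v.1.2, l), rfl⟩ : Y (v.1.2, l) ∈ S₂ ∪ Set.range Y))
    rwa [Fintype.card_fin] at h1
  have hr₂eq : ∀ (ω : DecodingInstance.{u} m n p s k) (z : Option (Fin k) → ω.F) (a : Fin m × Fin m),
      ∑ o, r₂ (a, o) ω * z o = ((∑ h, z (some h) • ω.gC h + z none • (ω.X + ω.E)) *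
        (∑ h, x h ω • ω.gA h).transpose) a.1 a.2 := fun ω z a => by
    rw [hYeq, Matrix.add_mul, Matrix.add_apply, Matrix.sum_mul, Matrix.sum_apply,
      Fintype.sum_option, add_comm]
    congr 1
    · refine Finset.sum_congr rfl fun h _ => ?_
      rw [Matrix.smul_mul, Matrix.smul_apply, smul_eq_mul, mul_comm]
      rfl
    · rw [Matrix.smul_mul, Matrix.smul_apply, smul_eq_mul, mul_comm]
      rfl
  have hcard₂ : m * m * (k + 1) = Fintype.card ((Fin m × Fin m) × Option (Fin k)) := by simp
  rw [hcard₂]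
  refine Solvable.compute_family hc₂ ?_
  have hloc : ∀ ω ∈ P₂, ω.E * (∑ h, x h ω • ω.gA h).transpose = 0 := fun ω hω =>
    ω.isRECP.mul_transpose_eq_zero ω.basis_A ω.basis_B ω.mem ω.rank_le (hxP ω hω).2
  have hk₂ := Solvable.kernel (Ω := DecodingInstance.{u} m n p s k) (f := fun ω => ω.F)
    (I := DecoderInput m n p s k) (S := S₂ ∪ Set.range Y ∪ Set.range r₂) (P := P₂)
    (spec := fun ω (out : Fin m × Fin n → ω.F) => ∀ i j, out (i, j) = ω.X i j)
    (c := m * n * (k * 6 + 1)) (fun a o => r₂ (a, o)) (fun a o => Or.inr ⟨(a, o), rfl⟩)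
    (fun ω hω => by
      obtain ⟨z, hz⟩ := IsRECPTypeII.exists_codeword_coeff ω.basis_C ω.mem (hloc ω hω)
      refine ⟨fun o => o.elim (-1) z, fun h0 => ?_, fun a => ?_⟩
      · exact neg_ne_zero.2 one_ne_zero (congrFun h0 none)
      · rw [hr₂eq]
        exact congrFun (congrFun hz a.1) a.2)
  simp only [Fintype.card_prod, Fintype.card_fin, Fintype.card_option] at hk₂
  refine hk₂ fun S₃ P₃ z hS₃ hP₃ hz hzP => ?_
  -- the codeword
  set Q : Fin m × Fin n → ∀ ω : DecodingInstance.{u} m n p s k, ω.F := fun v ω =>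
    ∑ h, (0 - z (some h) ω * (z none ω)⁻¹) * ω.gC h v.1 v.2 with hQ
  have hSS₃ : S ⊆ S₃ :=
    ((hSS₂.trans Set.subset_union_left).trans Set.subset_union_left).trans hS₃
  have hcQ : ∀ v, Computable S₃ (k * 6 + 1) (Q v) := fun v => by
    have h1 := Computable.sum fun h => (Computable.zero.sub ((Computable.mem (hz (some h))).mul
      (Computable.mem (hz none)).inv)).mul (Computable.mem (hSS₃ (hinC h v.1 v.2)))
    rwa [Fintype.card_fin] at h1
  rw [hcardY, ← Nat.zero_add (_ * _)]
  refine Solvable.compute_family hcQ (Solvable.output Q (fun o => Or.inr ⟨o, rfl⟩)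
    fun ω hω i j => ?_)
  have hne : z none ω = 0 → (fun h => z (some h) ω) ≠ 0 := fun h0 h1 =>
    (hzP ω hω).1 (funext fun o => by
      cases o with
      | none => exact h0
      | some h => exact congrFun h1 h)
  have h1 := ω.isRECP.codeword_eq ω.basis_C ω.mem (ω.basis_A.sum_mem fun h => x h ω)
    (ω.basis_A.ne_zero (hxP ω (hP₃ hω)).1) (hloc ω (hP₃ hω)) hne (by
      ext a b
      rw [← hr₂eq ω (fun o => z o ω) (a, b)]
      exact (hzP ω hω).2 (a, b))
  rw [← h1, Matrix.sum_apply]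
  rfl

theorem exists_decoder (m n p s k : ℕ) : ∃ T : Decoder m n p s k,
    T.cost ≤ decoderCost m n p s k ∧
      ∀ ω : DecodingInstance.{u} m n p s k, T.decode ω.gA ω.gB ω.gC (ω.X + ω.E) = ω.X := by
  obtain ⟨T, hT, hrun⟩ := solvable_decoding.{u} (m := m) (n := n) (p := p) (s := s) (k := k)
    |>.exists_tree
  refine ⟨T, hT, fun ω => ?_⟩
  ext i j
  rw [← hrun ω i j]
  change CompTree.run T _ (i, j) = _
  congr 2

end Decoding
-- The polynomial cost bound and the main theorem.
theorem kernelCost_mono {N N' L L' : ℕ} (hN : N ≤ N') (hL : L ≤ L') :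
    kernelCost N L ≤ kernelCost N' L' := by
  unfold kernelCost rowCost
  gcongr

theorem decoderCost_le {m n p s k : ℕ} (hmn : 0 < m + n) (hp : p ≤ m * n) (hs : s ≤ m * m)
    (hk : k ≤ m * n) : decoderCost m n p s k ≤ 250 * (m + n) ^ 250 := by
  set N := m + n with hN
  have hm : m ≤ N := Nat.le_add_right _ _
  have hn : n ≤ N := Nat.le_add_left _ _
  have hp' : p ≤ N * N := hp.trans (Nat.mul_le_mul hm hn)
  have hk' : k ≤ N * N := hk.trans (Nat.mul_le_mul hm hn)
  have hs' : s ≤ N * N := hs.trans (Nat.mul_le_mul hm hm)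
  have hk1 : k + 1 ≤ 2 * (N * N) := by
    have : 1 ≤ N * N := Nat.mul_pos hmn hmn
    omega
  have h1 : decoderCost m n p s k ≤
      N * N * (N * N * 6 + 1) + kernelCost (N * N) (2 * (N * N)) +
        N * N * (2 * (N * N)) * (N * 2 + 1) + N * N * (N * N * 2 + 1) + kernelCost (N * N) (N * N) +
        N * N * (N * N) * (N * (N * (N * 2 + 3) + 2) + 1) := by
    unfold decoderCost
    have e1 := kernelCost_mono (Nat.mul_le_mul hm hm) hk1
    have e2 := kernelCost_mono hs' hp'
    gcongr
  -- The bound has degree 7 in N, from the coefficients of the locator system; 250 exceeds the sum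
  -- of its coefficients and also serves as a generous exponent.
  have h2 : ∀ i ≤ 7, N ^ i ≤ N ^ 7 := fun i hi => Nat.pow_le_pow_right hmn hi
  refine h1.trans (le_trans ?_ (Nat.mul_le_mul_left 250
    (Nat.pow_le_pow_right hmn (by norm_num : 7 ≤ 250))))
  have a2 := h2 2 (by norm_num)
  have a3 := h2 3 (by norm_num)
  have a4 := h2 4 (by norm_num)
  have a5 := h2 5 (by norm_num)
  have a6 := h2 6 (by norm_num)
  unfold kernelCost rowCost
  ring_nf
  linarith

end RankECP

theorem mainTheorem8 :
    -- the pair is a rank error-correcting pair of type II for every `F`-linear subcode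
    (∀ (F : Type u) (K : Type v) [Field F] [Fintype F] [Field K] [Algebra F K]
        [FiniteDimensional F K] (m n : ℕ) (α α' : Module.Basis (Fin m) F K)
        (r : ℤ) (b : Fin n → K) (t : ℕ)
        (A : Submodule K (Fin n → K)) (B : Submodule K (Fin m → K))
        (C : Submodule K (Fin n → K)) (D : Submodule F (Fin n → K)),
        RankECP.IsDualBasis F α α' →
        RankECP.IsGabidulinTriple F α r b t A B C →
        D ≤ C.restrictScalars F →
        RankECP.IsRECPTypeII t (RankECP.matCode F α (A.restrictScalars F))
          (RankECP.matCode F α (B.restrictScalars F)) (RankECP.matCode F α' D)) ∧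
    -- decoding up to rank `t` with polynomially many operations in `F`
    (∃ c : ℕ, ∀ m n p s k : ℕ, p ≤ m * n → s ≤ m * m → k ≤ m * n →
      ∃ T : RankECP.Decoder m n p s k, RankECP.CompTree.cost T ≤ c * (m + n) ^ c ∧
        ∀ (F : Type u) (K : Type v) [Field F] [Fintype F] [Field K] [Algebra F K]
          [FiniteDimensional F K] (α α' : Module.Basis (Fin m) F K)
          (r : ℤ) (b : Fin n → K) (t : ℕ)
          (A : Submodule K (Fin n → K)) (B : Submodule K (Fin m → K))
          (C : Submodule K (Fin n → K)) (D : Submodule F (Fin n → K))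
          (gA : Fin p → Matrix (Fin m) (Fin n) F) (gB : Fin s → Matrix (Fin m) (Fin m) F)
          (gD : Fin k → Matrix (Fin m) (Fin n) F),
          RankECP.IsDualBasis F α α' →
          RankECP.IsGabidulinTriple F α r b t A B C →
          D ≤ C.restrictScalars F →
          RankECP.IsBasisOf gA (RankECP.matCode F α (A.restrictScalars F)) →
          RankECP.IsBasisOf gB (RankECP.matCode F α (B.restrictScalars F)) →
          RankECP.IsBasisOf gD (RankECP.matCode F α' D) →
          ∀ X ∈ RankECP.matCode F α' D, ∀ E : Matrix (Fin m) (Fin n) F, E.rank ≤ t →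
            RankECP.Decoder.decode T gA gB gD (X + E) = X) ∧
    -- every generalized Gabidulin code of dimension at most `n - 2t` is contained in such a `C`
    (∀ (F : Type u) (K : Type v) [Field F] [Fintype F] [Field K] [Algebra F K]
        [FiniteDimensional F K] (m n : ℕ) (α : Module.Basis (Fin m) F K)
        (r : ℤ) (g : Fin n → K) (t k : ℕ),
        n ≤ m → IsCoprime r (m : ℤ) → LinearIndependent F g →
        0 < t → 1 ≤ k → k + 2 * t ≤ n →
        ∃ (b : Fin n → K) (A : Submodule K (Fin n → K)) (B : Submodule K (Fin m → K))
          (C : Submodule K (Fin n → K)),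
          RankECP.IsGabidulinTriple F α r b t A B C ∧ RankECP.gabidulin F k r g ≤ C) := by
  refine ⟨?_, ⟨250, fun m n p s k hp hs hk => ?_⟩, ?_⟩
  · intro F K _ _ _ _ _ m n α α' r b t A B C D hd h hD
    exact h.isRECPTypeII hd hD
  · rcases Nat.eq_zero_or_pos (m + n) with hmn | hmn
    -- Here the cost bound is 0, but no instance exists, since n ≥ 2t > 0.
    · refine ⟨.output fun _ => Sum.inr 0, Nat.zero_le _, ?_⟩
      intro F K _ _ _ _ _ α α' r b t A B C D gA gB gD hd h
      have := h.t_pos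
      have := h.two_mul_t_le
      omega
    · obtain ⟨T, hT, hdec⟩ := RankECP.exists_decoder.{u} m n p s k
      refine ⟨T, hT.trans (RankECP.decoderCost_le hmn hp hs hk), ?_⟩
      intro F K _ _ _ _ _ α α' r b t A B C D gA gB gD hd h hD hA hB hC X hX E hE
      exact hdec ⟨F, t, _, _, _, gA, gB, gD, X, E, h.isRECPTypeII hd hD, hA, hB, hC, hX, hE⟩
  · intro F K _ _ _ _ _ m n α r g t k hnm hr hg ht _ hk
    exact RankECP.exists_isGabidulinTriple α hnm hr hg ht hk
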